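/- Setting. For integers $n,d\ge 0$ consider instances $(f,C)$ of mixed-integer convex optimization $\inf\{f(x,y):(x,y)\in C\cap(\mathbb Z^n\times\mathbb R^d)\}$, where $f:\mathbb R^n\times\mathbb R^d\to\mathbb R$ is convex and $C\subseteq\mathbb R^n\times\mathbb R^d$ is closed and convex. The points of $C\cap(\mathbb Z^n\times\mathbb R^d)$ are the feasible solutions, and an $\epsilon$-approximate solution is a feasible solution whose objective value is at most $f(z')+\epsilon$ for every feasible solution $z'$. Let $\mathcal I_{n,d,R,\rho,M}$ be the set of all instances that have a feasible solution and satisfy: (i) $C\subseteq[-R,R]^{n+d}$; (ii) for every optimal solution $(x^\star,y^\star)$ there is $\hat y\in\mathbb R^d$ with $\{(x^\star,y):\|y-\hat y\|_\infty\le\rho\}\subseteq C$; (iii) for every $x\in[-R,R]^n\cap\mathbb Z^n$, $f$ is $M$-Lipschitz with respect to $\|\cdot\|_\infty$ on $\{x\}\times[-R,R]^d$. A first-order chart $\mathcal G$ for $\mathcal I_{n,d,R,\rho,M}$ assigns to every $z\in[-R,R]^{n+d}$ and every instance $(f,C)$ in the class: a vector $g^{\rm sep}_z(f,C)$, equal to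 $0$ if $z\in C$, and otherwise a vector of Euclidean norm $1$ with $\langle g^{\rm sep}_z(f,C),z'\rangle<\langle g^{\rm sep}_z(f,C),z\rangle$ for all $z'\in C$; the value $g^{\rm val}_z(f,C)=f(z)$; and a subgradient $g^{\rm sub}_z(f,C)\in\partial f(z)$. The full-information first-order oracle based on $\mathcal G$ allows, in each query, to choose $z\in[-R,R]^{n+d}$ and to receive one of $g^{\rm sep}_z(f,C)$, $g^{\rm val}_z(f,C)$, $g^{\rm sub}_z(f,C)$ (the one asked for). A query strategy $D$ maps every finite sequence of query-response pairs to the next query. For a strategy $D$ and an instance $I$, $\mathrm{icomp}_\epsilon(D,I)\in\mathbb N\cup\{\infty\}$ is the least $k\ge 0$ such that all instances of the class that give the same responses as $I$ to the first $k$ queries of $D$ on $I$ have a common $\epsilon$-approximate solution, and the $\epsilon$-information complexity of the class is $\mathrm{icomp}_\epsilon(\mathcal I_{n,d,R,\rho,M},\mathcal O(\mathcal G))=\inf_D\sup_{I\in\mathcal I_{n,d,R,\rho,M}}\mathrm{icomp}_\epsilon(D,I)$. Corollary. There is an absolute constant $c>0$ such that for all integers $n,d\ge 0$ with $n+d\ge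 1$ and all reals $R\ge 1$, $0<\rho\le R$, $M>0$, there is a first-order chart $\mathcal G$ for $\mathcal I_{n,d,R,\rho,M}$ such that for every $0<\epsilon<MR$ the full-information first-order oracle based on $\mathcal G$ satisfies $$\mathrm{icomp}_\epsilon(\mathcal I_{n,d,R,\rho,M},\mathcal O(\mathcal G))\ \ge\ c\,2^n\left(1+d\log\frac{MR}{\min\{\rho,1\}\,\epsilon}\right).$$ -/

import Mathlib

namespace MICO

/-- The space `ℝⁿ × ℝᵈ`; the first component holds the integer variables. Its norm as a product
of `Fin _ → ℝ` is the `ℓ_∞` norm. -/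
abbrev Space (n d : ℕ) : Type := (Fin n → ℝ) × (Fin d → ℝ)

/-- The standard inner product on `ℝⁿ × ℝᵈ`. -/
def dot {n d : ℕ} (u v : Space n d) : ℝ :=
  (∑ i, u.1 i * v.1 i) + ∑ j, u.2 j * v.2 j

/-- The box `[-R, R]^{n+d}`. -/
def box (n d : ℕ) (R : ℝ) : Set (Space n d) := {z | ‖z‖ ≤ R}

/-- An instance `inf {f(x, y) : (x, y) ∈ C, (x, y) ∈ ℤⁿ × ℝᵈ}` of mixed-integer convex
optimization: `f` is convex on the whole space and `C` is closed and convex. -/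
structure Instance (n d : ℕ) where
  /-- the objective function -/
  f : Space n d → ℝ
  /-- the feasible region of the continuous relaxation -/
  C : Set (Space n d)
  convex_f : ConvexOn ℝ Set.univ f
  closed_C : IsClosed C
  convex_C : Convex ℝ C

/-- The mixed-integer points `ℤⁿ × ℝᵈ`. -/
def mixedInteger (n d : ℕ) : Set (Space n d) := {z | ∀ i, ∃ k : ℤ, z.1 i = (k : ℝ)}

namespace Instance

variable {n d : ℕ}

/-- Feasible solutions: the points of `C ∩ (ℤⁿ × ℝᵈ)`. -/
def feasible (I : Instance n d) : Set (Space n d) := I.C ∩ mixedInteger n d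

/-- `ε`-approximate solutions. -/
def approxSolutions (I : Instance n d) (ε : ℝ) : Set (Space n d) :=
  {z | z ∈ I.feasible ∧ ∀ z' ∈ I.feasible, I.f z ≤ I.f z' + ε}

/-- Optimal solutions. -/
def optimalSolutions (I : Instance n d) : Set (Space n d) :=
  {z | z ∈ I.feasible ∧ ∀ z' ∈ I.feasible, I.f z ≤ I.f z'}

end Instance

/-- The class `𝓘_{n,d,R,ρ,M}`. -/
structure IsInClass {n d : ℕ} (R ρ M : ℝ) (I : Instance n d) : Prop where
  /-- the instance has a feasible solution -/
  feasible_nonempty : I.feasible.Nonempty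
  /-- `C` lies in the box `[-R, R]^{n+d}` -/
  subset_box : I.C ⊆ box n d R
  /-- the fiber of every optimal solution contains a `d`-dimensional `ℓ_∞` ball of radius `ρ`
  that is contained in `C` -/
  deep_fiber : ∀ z ∈ I.optimalSolutions, ∃ yhat : Fin d → ℝ,
    ∀ y : Fin d → ℝ, ‖y - yhat‖ ≤ ρ → (z.1, y) ∈ I.C
  /-- `f` is `M`-Lipschitz for the `ℓ_∞` norm on `{x} × [-R, R]^d`,
  for every `x ∈ [-R, R]^n ∩ ℤ^n` -/
  lipschitz : ∀ (x : Fin n → ℝ) (y y' : Fin d → ℝ), (∀ i, ∃ k : ℤ, x i = (k : ℝ)) →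
    ‖x‖ ≤ R → ‖y‖ ≤ R → ‖y'‖ ≤ R → |I.f (x, y) - I.f (x, y')| ≤ M * ‖y - y'‖

/-- The class `𝓘_{n,d,R,ρ,M}` as a set of instances. -/
def instanceClass (n d : ℕ) (R ρ M : ℝ) : Set (Instance n d) := {I | IsInClass R ρ M I}

/-- `g` is a subgradient of `f` at `z`. -/
def IsSubgradient {n d : ℕ} (f : Space n d → ℝ) (z g : Space n d) : Prop :=
  ∀ z', f z + dot g (z' - z) ≤ f z'

/-- A first-order chart for `𝓘_{n,d,R,ρ,M}`: for every point `z` of the box, a separation map, a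
value map and a subgradient map on the instances. Only their values on instances of the class
matter. -/
structure FirstOrderChart (n d : ℕ) (R ρ M : ℝ) where
  /-- separating hyperplanes -/
  sep : box n d R → Instance n d → Space n d
  /-- function values -/
  val : box n d R → Instance n d → ℝ
  /-- subgradients -/
  sub : box n d R → Instance n d → Space n d
  sep_of_mem : ∀ (z : box n d R), ∀ I ∈ instanceClass n d R ρ M, z.1 ∈ I.C → sep z I = 0
  sep_of_notMem : ∀ (z : box n d R), ∀ I ∈ instanceClass n d R ρ M, z.1 ∉ I.C →
    ∀ z' ∈ I.C, dot (sep z I) z' < dot (sep z I) z.1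
  /-- nonzero responses are normalized to Euclidean length one -/
  sep_normalized : ∀ (z : box n d R), ∀ I ∈ instanceClass n d R ρ M, z.1 ∉ I.C →
    dot (sep z I) (sep z I) = 1
  val_eq : ∀ (z : box n d R), ∀ I ∈ instanceClass n d R ρ M, val z I = I.f z.1
  sub_isSubgradient : ∀ (z : box n d R), ∀ I ∈ instanceClass n d R ρ M,
    IsSubgradient I.f z.1 (sub z I)

/-- An oracle: a family of queries (indexed by `Query`) and a set of responses; every query is a
function from instances to responses. -/
structure Oracle (Inst : Type) where
  /-- the queries -/
  Query : Type
  /-- the possible responses -/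
  Resp : Type
  /-- the response to a query for an instance -/
  answer : Query → Inst → Resp

/-- A query strategy maps every finite sequence of query-response pairs to the next query. -/
def Oracle.Strategy {Inst : Type} (O : Oracle Inst) : Type :=
  List (O.Query × O.Resp) → O.Query

/-- The first `k` query-response pairs, in chronological order, of the strategy `D` on `I`. -/
def Oracle.transcript {Inst : Type} (O : Oracle Inst) (D : O.Strategy) (I : Inst) :
    ℕ → List (O.Query × O.Resp)
  | 0 => []
  | k + 1 => O.transcript D I k ++
      [(D (O.transcript D I k), O.answer (D (O.transcript D I k)) I)]

/-- The query number `i` (counted from `0`) that the strategy `D` makes on the instance `I`. -/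
def Oracle.query {Inst : Type} (O : Oracle Inst) (D : O.Strategy) (I : Inst) (i : ℕ) : O.Query :=
  D (O.transcript D I i)

/-- The `ε`-information complexity of the instance `I` for the strategy `D`: the least `k` such
that all instances of `𝓘` with the same responses as `I` to the first `k` queries of `D` have a
common `ε`-approximate solution (`⊤` if there is no such `k`). -/
noncomputable def icompInstance {n d : ℕ} (ε : ℝ) (𝓘 : Set (Instance n d))
    (O : Oracle (Instance n d)) (D : O.Strategy) (I : Instance n d) : ℕ∞ :=
  ⨅ (k : ℕ) (_ : ∃ z : Space n d, ∀ J ∈ 𝓘,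
    (∀ i < k, O.answer (O.query D I i) J = O.answer (O.query D I i) I) →
      z ∈ J.approxSolutions ε), (k : ℕ∞)

/-- The `ε`-information complexity of the class `𝓘` with respect to the oracle `O`. -/
noncomputable def icomp {n d : ℕ} (ε : ℝ) (𝓘 : Set (Instance n d))
    (O : Oracle (Instance n d)) : ℕ∞ :=
  ⨅ D : O.Strategy, ⨆ I ∈ 𝓘, icompInstance ε 𝓘 O D I

/-- The queries of the full-information first-order oracle: at any point of the box one may ask
for a separating hyperplane, for the function value, or for a subgradient. -/
inductive FirstOrderQuery (n d : ℕ) (R : ℝ) : Type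
  | sep (z : box n d R)
  | val (z : box n d R)
  | sub (z : box n d R)

/-- The full-information first-order oracle based on the chart `G`: it returns the complete
separating hyperplane, function value or subgradient that `G` selects. -/
def fullInformationOracle {n d : ℕ} {R ρ M : ℝ} (G : FirstOrderChart n d R ρ M) :
    Oracle (Instance n d) where
  Query := FirstOrderQuery n d R
  Resp := Space n d ⊕ ℝ
  answer q I := match q with
    | .sep z => Sum.inl (G.sep z I)
    | .val z => Sum.inr (G.val z I)
    | .sub z => Sum.inl (G.sub z I)

end MICO

/-!
The lower bound is proved by an adversary that hides one convex function of `(x, y)`, either in the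
objective or in the feasible region.

The hidden function (`hidden`) is a maximum of pieces. For every vertex `v` of the cube `[0, 1]ⁿ`
and every continuous coordinate there is a piece `φ(y_i / R) + 2 * tilt v x`, where `φ` is an unknown
member of a family of convex functions on the line and `tilt v` vanishes at `v` and is at most `-1`
at the other vertices; so each of the `2 ^ n` integer fibers has `d` independent unknown functions.
A further piece per fiber cuts off the low levels unless the fiber is deep. A point of low level
identifies the deep fiber and all its one-dimensional functions (`OnlyDeep.not_common`).

On the line, the unknown function has `m` binary digits of which a query for value and slope reveals
at most one (`Resists`). Two families are used (`Profile`): `z ↦ ± z`, with one digit, for which the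
gap between the levels is as large as possible, so that it covers all `ε < M R`; and hierarchical
functions (`tree`), where every digit selects one of two subintervals, and outside the selected one
the function does not depend on further digits. There levels shrink by the factor `24` and lengths
by the factor `4` with every digit, so the depth may be of order `log (M R / ε)` if the function is
the objective, and of order `log (R / ρ)` if a sublevel set is the feasible region.

The adversary on the line always gives the largest value that is still possible. Therefore
adversaries for the pieces combine to one for their maximum (`Survives.step`): at a queried point,
take the piece with the largest possible value, breaking ties in a fixed order, and reveal one digit
of this piece only; the value and the subgradient of the maximum are then determined. A fiber is
revealed not to be deep only when all its digits are known. Hence a strategy needs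
`2 ^ n * (d * m + 1) - 1` queries (`exists_chart_le_icomp`).

The chart must answer with the gradient of the leading piece, so it has to know the parameter of a
hard instance. To this end a multiple of `max 0 (‖z‖ - R)` is added to the objective: it does not
change any answer, since queries are made in the box, but makes the instance determine its parameter
(`exists_injective_hardInstance`). One chart then serves all `ε`, both families, all depths and both
ways of hiding the function.
-/

namespace MICO

/-! ### Subgradients and separating vectors for the standard inner product -/

section General

variable {n d : ℕ}

lemma dot_add (u v w : Space n d) : dot u (v + w) = dot u v + dot u w := by
  simp only [dot, Prod.fst_add, Prod.snd_add, Pi.add_apply, mul_add, Finset.sum_add_distrib]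
  ring

lemma dot_smul (a : ℝ) (u v : Space n d) : dot u (a • v) = a * dot u v := by
  simp only [dot, Prod.smul_fst, Prod.smul_snd, Pi.smul_apply, smul_eq_mul, mul_add,
    Finset.mul_sum]
  congr 1 <;> exact Finset.sum_congr rfl fun i _ => by ring

lemma dot_comm (u v : Space n d) : dot u v = dot v u := by
  simp only [dot, mul_comm]

lemma smul_dot (a : ℝ) (u v : Space n d) : dot (a • u) v = a * dot u v := by
  rw [dot_comm, dot_smul, dot_comm]

lemma dot_sub (u v w : Space n d) : dot u (v - w) = dot u v - dot u w := by
  have h := dot_add u (v - w) w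
  rw [sub_add_cancel] at h
  linarith

lemma zero_dot (u : Space n d) : dot 0 u = 0 := by
  simp [dot]

lemma dot_self_nonneg (u : Space n d) : 0 ≤ dot u u :=
  add_nonneg (Finset.sum_nonneg fun _ _ => mul_self_nonneg _)
    (Finset.sum_nonneg fun _ _ => mul_self_nonneg _)

lemma eq_zero_of_dot_self {u : Space n d} (h : dot u u = 0) : u = 0 := by
  have h1 : 0 ≤ ∑ i, u.1 i * u.1 i := Finset.sum_nonneg fun _ _ => mul_self_nonneg _
  have h2 : 0 ≤ ∑ i, u.2 i * u.2 i := Finset.sum_nonneg fun _ _ => mul_self_nonneg _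
  unfold dot at h
  have h3 : ∑ i, u.1 i * u.1 i = 0 := by linarith
  have h4 : ∑ i, u.2 i * u.2 i = 0 := by linarith
  rw [Finset.sum_eq_zero_iff_of_nonneg fun _ _ => mul_self_nonneg _] at h3 h4
  ext i
  · simpa using h3 i (Finset.mem_univ i)
  · simpa using h4 i (Finset.mem_univ i)

/-- Every continuous linear functional is the inner product with a vector. -/
lemma exists_dot_eq (φ : Space n d →L[ℝ] ℝ) : ∃ g : Space n d, ∀ z, dot g z = φ z := by
  classical
  refine ⟨(fun i => φ (Pi.single i 1, 0), fun j => φ (0, Pi.single j 1)), fun z => ?_⟩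
  have hz : z = (∑ i, z.1 i • ((Pi.single i 1, 0) : Space n d))
      + ∑ j, z.2 j • ((0, Pi.single j 1) : Space n d) := by
    ext i
    · simp [Prod.fst_sum, Finset.sum_apply, Pi.single_apply]
    · simp [Prod.snd_sum, Finset.sum_apply, Pi.single_apply]
  conv_rhs => rw [hz]
  simp only [map_add, map_sum, map_smul, smul_eq_mul, dot]
  congr 1 <;> exact Finset.sum_congr rfl fun i _ => mul_comm _ _

/-- A finite convex function on the whole space has a subgradient at every point: separate the
point `(z, f z)` of the graph from the open strict epigraph. -/
lemma exists_isSubgradient {f : Space n d → ℝ} (hf : ConvexOn ℝ Set.univ f) (z : Space n d) :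
    ∃ g, IsSubgradient f z g := by
  have hc : Continuous f := by
    simpa [continuousOn_univ] using hf.continuousOn isOpen_univ
  have hopen : IsOpen {p : Space n d × ℝ | f p.1 < p.2} :=
    isOpen_lt (hc.comp continuous_fst) continuous_snd
  have hconv : Convex ℝ {p : Space n d × ℝ | f p.1 < p.2} := by
    simpa using hf.convex_strict_epigraph
  obtain ⟨φ, hφ⟩ := geometric_hahn_banach_open_point (x := (z, f z)) hconv hopen (by simp)
  have hsplit : ∀ (w : Space n d) (t : ℝ), φ (w, t) = φ (w, 0) + t * φ (0, 1) := by
    intro w t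
    have : ((w, t) : Space n d × ℝ) = (w, 0) + t • ((0, 1) : Space n d × ℝ) := by
      ext <;> simp
    rw [this, map_add, map_smul, smul_eq_mul]
  have hb : φ (0, 1) < 0 := by
    have h := hφ (z, f z + 1) (by simp)
    rw [hsplit, hsplit z (f z)] at h
    linarith
  obtain ⟨g, hg⟩ := exists_dot_eq (φ.comp (ContinuousLinearMap.inl ℝ (Space n d) ℝ))
  have hg' : ∀ w, dot g w = φ (w, 0) := fun w => by rw [hg]; rfl
  refine ⟨(-(φ (0, 1))⁻¹) • g, fun w => ?_⟩
  -- strict inequalities above `f w` give the weak inequality at `f w`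
  refine le_of_forall_gt_imp_ge_of_dense fun t ht => ?_
  have h := hφ (w, t) ht
  rw [hsplit, hsplit z (f z), ← hg', ← hg'] at h
  rw [smul_dot, dot_sub]
  have hne : φ (0, 1) ≠ 0 := hb.ne
  have key : (t - f z) * (-φ (0, 1)) ≥ dot g w - dot g z := by nlinarith
  have : -(φ (0, 1))⁻¹ * (dot g w - dot g z) ≤ t - f z := by
    rw [← inv_neg, inv_mul_le_iff₀ (by linarith)]
    linarith
  linarith

/-- The normalization of `g` to Euclidean length one. -/
noncomputable def normalize (g : Space n d) : Space n d := (√(dot g g))⁻¹ • g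

lemma normalize_separates {C : Set (Space n d)} {z g : Space n d} (hC : C.Nonempty)
    (hg : ∀ z' ∈ C, dot g z' < dot g z) :
    (∀ z' ∈ C, dot (normalize g) z' < dot (normalize g) z) ∧
      dot (normalize g) (normalize g) = 1 := by
  have hpos : 0 < dot g g := by
    refine lt_of_le_of_ne (dot_self_nonneg g) fun h => ?_
    obtain ⟨w, hw⟩ := hC
    have := hg w hw
    rw [eq_zero_of_dot_self h.symm, zero_dot, zero_dot] at this
    exact lt_irrefl _ this
  have hs : 0 < √(dot g g) := Real.sqrt_pos.2 hpos
  refine ⟨fun z' hz' => ?_, ?_⟩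
  · rw [normalize, smul_dot, smul_dot]
    exact mul_lt_mul_of_pos_left (hg z' hz') (inv_pos.2 hs)
  · rw [normalize, smul_dot, dot_smul]
    nth_rewrite 3 [← Real.mul_self_sqrt hpos.le]
    field_simp

lemma exists_separating {C : Set (Space n d)} (hconv : Convex ℝ C) (hclosed : IsClosed C)
    (hC : C.Nonempty) {z : Space n d} (hz : z ∉ C) :
    ∃ g, (∀ z' ∈ C, dot g z' < dot g z) ∧ dot g g = 1 := by
  obtain ⟨φ, u, h1, h2⟩ := geometric_hahn_banach_closed_point hconv hclosed hz
  obtain ⟨g, hg⟩ := exists_dot_eq φ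
  exact ⟨normalize g, normalize_separates hC fun z' hz' => by
    rw [hg, hg]; exact (h1 z' hz').trans h2⟩

lemma convexOn_of_isSubgradient {f : Space n d → ℝ} (h : ∀ z, ∃ g, IsSubgradient f z g) :
    ConvexOn ℝ Set.univ f := by
  refine ⟨convex_univ, fun x _ y _ a b ha hb hab => ?_⟩
  obtain ⟨g, hg⟩ := h (a • x + b • y)
  have hx := hg x
  have hy := hg y
  have e : a * dot g (x - (a • x + b • y)) + b * dot g (y - (a • x + b • y)) = 0 := by
    simp only [dot_sub, dot_add, dot_smul]
    linear_combination -(a * dot g x + b * dot g y) * hab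
  simp only [smul_eq_mul]
  have h1 := mul_le_mul_of_nonneg_left hx ha
  have h2 := mul_le_mul_of_nonneg_left hy hb
  have h3 : (a + b) * f (a • x + b • y) = f (a • x + b • y) := by rw [hab, one_mul]
  linarith

end General

/-! ### One-dimensional search problems -/

/-- `Resists φ fl r V`: an adversary that answers value-and-slope queries to the hidden function
`φ l`, `l ∈ V`, can survive `r` queries, leaving a nontrivial set of candidates before each of
them and exactly one candidate at the end. Each answer must be the largest value possible at the
queried point, and at least `fl`; this is what lets adversaries for several coordinates be combined
when the hidden functions are combined by taking their maximum. -/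
def Resists (φ : List Bool → ℝ → ℝ × ℝ) (fl : ℝ) : ℕ → Set (List Bool) → Prop
  | 0, V => ∃ l, V = {l}
  | r + 1, V => V.Nontrivial ∧ ∀ z, ∃ V' ⊆ V, Resists φ fl r V' ∧
      ∃ w, (∀ l ∈ V', φ l z = w) ∧ (∀ l ∈ V, (φ l z).1 ≤ w.1) ∧ fl ≤ w.1

namespace Resists

variable {φ : List Bool → ℝ → ℝ × ℝ} {fl : ℝ} {r : ℕ} {V : Set (List Bool)}

lemma nonempty (h : Resists φ fl r V) : V.Nonempty := by
  cases r with
  | zero => obtain ⟨l, rfl⟩ := h; exact Set.singleton_nonempty l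
  | succ r => exact h.1.nonempty

/-- One step of the adversary, for an arbitrary number of remaining queries. -/
lemma step (h : Resists φ fl r V) (z : ℝ) :
    ∃ V' ⊆ V, Resists φ fl (r - 1) V' ∧ ∃ w, (∀ l ∈ V', φ l z = w) ∧
      (∀ l ∈ V, (φ l z).1 ≤ w.1) ∧ (0 < r → fl ≤ w.1) := by
  cases r with
  | zero =>
    have h' := h
    obtain ⟨l, rfl⟩ := h'
    refine ⟨{l}, subset_rfl, h, φ l z, ?_, ?_, fun h => absurd h (lt_irrefl _)⟩
    · rintro _ rfl; rfl
    · rintro _ rfl; rfl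
  | succ r =>
    obtain ⟨V', hV', hr, w, h1, h2, h3⟩ := h.2 z
    exact ⟨V', hV', hr, w, h1, h2, fun _ => h3⟩

/-- Prefixing all candidates by a digit preserves resistance if the new answers are a monotone
function of the old ones. -/
lemma cons {φ' : List Bool → ℝ → ℝ × ℝ} {fl' : ℝ} (b : Bool) (e : ℝ → ℝ)
    (T : ℝ → ℝ × ℝ → ℝ × ℝ) (hT : ∀ l z, φ' (b :: l) z = T z (φ l (e z)))
    (hmono : ∀ z p q, p.1 ≤ q.1 → (T z p).1 ≤ (T z q).1)
    (hfl : ∀ z p, fl ≤ p.1 → fl' ≤ (T z p).1) (h : Resists φ fl r V) :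
    Resists φ' fl' r (List.cons b '' V) := by
  induction r generalizing V with
  | zero =>
    obtain ⟨l, rfl⟩ := h
    exact ⟨b :: l, Set.image_singleton⟩
  | succ r ih =>
    refine ⟨h.1.image List.cons_injective, fun z => ?_⟩
    obtain ⟨V', hV', hr, w, h1, h2, h3⟩ := h.2 (e z)
    refine ⟨List.cons b '' V', Set.image_mono hV', ih hr, T z w, ?_, ?_, hfl _ _ h3⟩
    · rintro _ ⟨l, hl, rfl⟩
      rw [hT, h1 l hl]
    · rintro _ ⟨l, hl, rfl⟩
      rw [hT]
      exact hmono _ _ _ (h2 l hl)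

end Resists

/-- A family of convex functions on the line, given by their values and slopes, together with the
levels used in the lower bound: the functions indexed by `words` reach the level `low` in
`[-1, 1]`, stay at most `tau` on an interval of radius `rad` about their center, have pairwise
disjoint strict sublevel sets for the level `sh`, and the identity of the hidden function resists
`rank` queries. -/
structure Profile where
  /-- value and slope -/
  φ : List Bool → ℝ → ℝ × ℝ
  /-- the indices of the hard instances -/
  words : Set (List Bool)
  /-- a point of level at most `low` -/
  ctr : List Bool → ℝ
  /-- the level reached by every function -/
  low : ℝ
  /-- the level that defines feasible regions -/
  tau : ℝ
  /-- the level below which two functions cannot be at the same point -/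
  sh : ℝ
  /-- the radius of an interval of points of level at most `tau` -/
  rad : ℝ
  /-- the number of queries that are resisted -/
  rank : ℕ
  sub : ∀ l z w, (φ l z).1 + (φ l z).2 * (w - z) ≤ (φ l w).1
  abs_slope_le : ∀ l z, |(φ l z).2| ≤ 1
  val_le_one : ∀ l z, |z| ≤ 1 → (φ l z).1 ≤ 1
  neg_one_le_low : -1 ≤ low
  low_le_tau : low ≤ tau
  tau_lt_sh : tau < sh
  sh_le_one : sh ≤ 1
  rad_nonneg : 0 ≤ rad
  val_ctr_le : ∀ l ∈ words, (φ l (ctr l)).1 ≤ low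
  ball : ∀ l ∈ words, ∀ z, |z - ctr l| ≤ rad → |z| ≤ 1 ∧ (φ l z).1 ≤ tau
  eq_of_lt : ∀ l ∈ words, ∀ l' ∈ words, ∀ z, (φ l z).1 < sh → (φ l' z).1 < sh → l = l'
  resists : Resists φ sh rank words

/-- The family of the two functions `z ↦ z` and `z ↦ -z`. -/
noncomputable def signProfile : Profile where
  φ l z := if l = [true] then (z, 1) else (-z, -1)
  words := {[true], [false]}
  ctr l := if l = [true] then -1 else 1
  low := -1
  tau := -1 / 2
  sh := 0
  rad := 0
  rank := 1
  sub l z w := by split_ifs <;> simp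
  abs_slope_le l z := by split_ifs <;> simp
  val_le_one l z hz := by
    have := abs_le.1 hz
    split_ifs <;> simp <;> linarith
  neg_one_le_low := le_rfl
  low_le_tau := by norm_num
  tau_lt_sh := by norm_num
  sh_le_one := by norm_num
  rad_nonneg := le_rfl
  val_ctr_le l _ := by split_ifs <;> simp
  ball l _ z hz := by
    have : z = if l = [true] then -1 else 1 := by
      have := abs_nonpos_iff.1 hz
      linarith
    split_ifs at this ⊢ <;> subst this <;> norm_num
  eq_of_lt l hl l' hl' z h h' := by
    rcases hl with rfl | rfl <;> rcases hl' with rfl | rfl <;> simp at h h' ⊢ <;> linarith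
  resists := by
    refine ⟨⟨[true], by simp, [false], by simp, by simp⟩, fun z => ?_⟩
    rcases le_total 0 z with hz | hz
    · refine ⟨{[true]}, by simp, ⟨_, rfl⟩, (z, 1), ?_, ?_, hz⟩
      · rintro _ rfl; simp
      · rintro _ (rfl | rfl) <;> simp [hz]
    · refine ⟨{[false]}, by simp, ⟨_, rfl⟩, (-z, -1), ?_, ?_, by simpa using hz⟩
      · rintro _ rfl; simp
      · rintro _ (rfl | rfl) <;> simp; linarith

/-- A slope of the absolute value. -/
noncomputable def absSlope (z : ℝ) : ℝ := if 0 ≤ z then 1 else -1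

lemma abs_add_absSlope_mul_le (z w : ℝ) : |z| + absSlope z * (w - z) ≤ |w| := by
  unfold absSlope
  split_ifs with h
  · rw [abs_of_nonneg h]; linarith [le_abs_self w]
  · rw [abs_of_neg (not_le.1 h)]; linarith [neg_abs_le w]

lemma abs_absSlope (z : ℝ) : |absSlope z| = 1 := by
  unfold absSlope; split_ifs <;> simp

/-- The center `± 1/2` of the subinterval of `[-1, 1]` selected by a digit. -/
noncomputable def digitCtr (b : Bool) : ℝ := if b then 1 / 2 else -(1 / 2)

/-- One level of the hierarchical functions: the maximum of `|z|` and of the affine image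
`3/4 + p/24` of the value `p` of the rescaled function. -/
noncomputable def treeStep (z : ℝ) (p : ℝ × ℝ) : ℝ × ℝ :=
  if |z| < 3 / 4 + p.1 / 24 then (3 / 4 + p.1 / 24, p.2 / 6) else (|z|, absSlope z)

/-- The hierarchical functions: the one indexed by `b :: l` is a flattened copy of the one indexed
by `l` in the interval of radius `1/4` about `digitCtr b`, and does not depend on `l` outside of
it. -/
noncomputable def tree : List Bool → ℝ → ℝ × ℝ
  | [], z => (|z|, absSlope z)
  | b :: l, z => treeStep z (tree l (4 * (z - digitCtr b)))

lemma treeStep_fst (z : ℝ) (p : ℝ × ℝ) : (treeStep z p).1 = max |z| (3 / 4 + p.1 / 24) := by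
  unfold treeStep
  split_ifs with h
  · exact (max_eq_right h.le).symm
  · exact (max_eq_left (not_lt.1 h)).symm

lemma tree_cons_fst (b : Bool) (l : List Bool) (z : ℝ) :
    (tree (b :: l) z).1 = max |z| (3 / 4 + (tree l (4 * (z - digitCtr b))).1 / 24) :=
  treeStep_fst _ _

lemma abs_digitCtr (b : Bool) : |digitCtr b| = 1 / 2 := by
  unfold digitCtr; split_ifs <;> norm_num [abs_of_pos]

lemma tree_sub (l : List Bool) (z w : ℝ) :
    (tree l z).1 + (tree l z).2 * (w - z) ≤ (tree l w).1 := by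
  induction l generalizing z w with
  | nil => exact abs_add_absSlope_mul_le z w
  | cons b l ih =>
    have h := ih (4 * (z - digitCtr b)) (4 * (w - digitCtr b))
    rw [tree_cons_fst b l w]
    by_cases hz : |z| < 3 / 4 + (tree l (4 * (z - digitCtr b))).1 / 24
    · refine le_max_of_le_right ?_
      simp only [tree, treeStep, if_pos hz]
      linarith
    · refine le_max_of_le_left ?_
      simp only [tree, treeStep, if_neg hz]
      exact abs_add_absSlope_mul_le z w

lemma abs_tree_snd_le (l : List Bool) (z : ℝ) : |(tree l z).2| ≤ 1 := by
  induction l generalizing z with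
  | nil => exact (abs_absSlope z).le
  | cons b l ih =>
    simp only [tree, treeStep]
    split_ifs
    · have := ih (4 * (z - digitCtr b))
      rw [abs_div, abs_of_pos (by norm_num : (0 : ℝ) < 6)]
      linarith
    · exact (abs_absSlope z).le

lemma tree_le_max (l : List Bool) (z : ℝ) : (tree l z).1 ≤ max 1 |z| := by
  induction l generalizing z with
  | nil => exact le_max_right _ _
  | cons b l ih =>
    rw [tree_cons_fst]
    refine max_le (le_max_right _ _) ?_
    have h1 := ih (4 * (z - digitCtr b))
    have h2 : |4 * (z - digitCtr b)| ≤ 4 * (|z| + 1 / 2) := by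
      rw [abs_mul, abs_of_pos (by norm_num : (0 : ℝ) < 4), ← abs_digitCtr b]
      gcongr
      exact abs_sub _ _
    have h3 := h1.trans (max_le_max le_rfl h2)
    rcases le_total 1 |z| with h | h
    · rw [max_eq_right h]
      rcases max_choice (1 : ℝ) (4 * (|z| + 1 / 2)) with h' | h' <;> rw [h'] at h3 <;> linarith
    · rw [max_eq_left h]
      rcases max_choice (1 : ℝ) (4 * (|z| + 1 / 2)) with h' | h' <;> rw [h'] at h3 <;> linarith

/-- Outside of `(-1, 1)` all hierarchical functions agree with the absolute value. -/
lemma tree_of_one_le_abs (l : List Bool) {z : ℝ} (hz : 1 ≤ |z|) :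
    tree l z = (|z|, absSlope z) := by
  cases l with
  | nil => rfl
  | cons b l =>
    simp only [tree, treeStep]
    rw [if_neg]
    have h1 := tree_le_max l (4 * (z - digitCtr b))
    have h2 : |4 * (z - digitCtr b)| ≤ 4 * (|z| + 1 / 2) := by
      rw [abs_mul, abs_of_pos (by norm_num : (0 : ℝ) < 4), ← abs_digitCtr b]
      gcongr
      exact abs_sub _ _
    have h3 := h1.trans (max_le (by linarith) h2)
    linarith

/-- The level that corresponds to the level `a` of the innermost function at depth `m`. -/
noncomputable def treeLevel (a : ℝ) : ℕ → ℝ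
  | 0 => a
  | m + 1 => 3 / 4 + treeLevel a m / 24

lemma treeLevel_le_one {a : ℝ} (ha : a ≤ 1) (m : ℕ) : treeLevel a m ≤ 1 := by
  induction m with
  | zero => exact ha
  | succ m ih => simp only [treeLevel]; linarith

lemma treeLevel_nonneg {a : ℝ} (ha : 0 ≤ a) (m : ℕ) : 0 ≤ treeLevel a m := by
  induction m with
  | zero => exact ha
  | succ m ih => simp only [treeLevel]; linarith

lemma treeLevel_sub (a a' : ℝ) (m : ℕ) :
    treeLevel a m - treeLevel a' m = (a - a') * (1 / 24) ^ m := by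
  induction m with
  | zero => simp [treeLevel]
  | succ m ih =>
    simp only [treeLevel, pow_succ]
    linarith

lemma treeLevel_strictMono (m : ℕ) : StrictMono fun a => treeLevel a m := by
  intro a a' h
  have h1 := treeLevel_sub a' a m
  have : 0 < (a' - a) * (1 / 24 : ℝ) ^ m := mul_pos (by linarith) (by positivity)
  simp only
  linarith

lemma abs_lt_one_of_tree_lt {l : List Bool} {z : ℝ} (h : (tree l z).1 < 1) : |z| < 1 := by
  by_contra! h'
  rw [tree_of_one_le_abs l h'] at h
  exact absurd h (not_lt.2 h')

/-- The minimizer of a hierarchical function. -/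
noncomputable def treeCtr : List Bool → ℝ
  | [] => 0
  | b :: l => digitCtr b + treeCtr l / 4

lemma abs_le_of_rescaled {b : Bool} {z : ℝ} (h : |4 * (z - digitCtr b)| ≤ 1) : |z| ≤ 3 / 4 := by
  have h2 := abs_digitCtr b
  rw [abs_mul, abs_of_pos (by norm_num : (0 : ℝ) < 4)] at h
  have h3 := abs_add_le (z - digitCtr b) (digitCtr b)
  rw [sub_add_cancel] at h3
  linarith

lemma tree_ball (l : List Bool) {z r : ℝ} (hr : r < 1) (hr0 : 0 ≤ r)
    (hz : |z - treeCtr l| ≤ r / 4 ^ l.length) :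
    |z| ≤ 1 ∧ (tree l z).1 ≤ treeLevel r l.length := by
  induction l generalizing z with
  | nil =>
    simp only [treeCtr, sub_zero, List.length_nil, pow_zero, div_one] at hz
    exact ⟨hz.trans hr.le, hz⟩
  | cons b l ih =>
    have h1 : |4 * (z - digitCtr b) - treeCtr l| ≤ r / 4 ^ l.length := by
      have e : 4 * (z - digitCtr b) - treeCtr l = 4 * (z - treeCtr (b :: l)) := by
        simp only [treeCtr]; ring
      rw [e, abs_mul, abs_of_pos (by norm_num : (0 : ℝ) < 4)]
      rw [List.length_cons, pow_succ, ← div_div] at hz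
      linarith
    obtain ⟨h2, h3⟩ := ih h1
    have h4 := abs_le_of_rescaled h2
    refine ⟨by linarith, ?_⟩
    rw [tree_cons_fst]
    have h5 := treeLevel_nonneg hr0 l.length
    refine max_le ?_ ?_ <;> simp only [List.length_cons, treeLevel] <;> linarith

lemma tree_eq_of_lt {l l' : List Bool} (hlen : l.length = l'.length) {z : ℝ}
    (h : (tree l z).1 < treeLevel 1 l.length) (h' : (tree l' z).1 < treeLevel 1 l'.length) :
    l = l' := by
  induction l generalizing l' z with
  | nil => exact (List.length_eq_zero_iff.1 hlen.symm).symm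
  | cons b l ih =>
    cases l' with
    | nil => simp at hlen
    | cons b' l' =>
      rw [tree_cons_fst] at h h'
      simp only [List.length_cons, treeLevel, max_lt_iff, add_lt_add_iff_left] at h h'
      have h1 : (tree l (4 * (z - digitCtr b))).1 < treeLevel 1 l.length := by linarith [h.2]
      have h2 : (tree l' (4 * (z - digitCtr b'))).1 < treeLevel 1 l'.length := by
        linarith [h'.2]
      have hb : b = b' := by
        have h3 := abs_lt_one_of_tree_lt (h1.trans_le (treeLevel_le_one le_rfl _))
        have h4 := abs_lt_one_of_tree_lt (h2.trans_le (treeLevel_le_one le_rfl _))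
        rw [abs_lt] at h3 h4
        cases b <;> cases b' <;> simp [digitCtr] at h3 h4 ⊢ <;> linarith
      subst hb
      rw [ih (by simpa using hlen) h1 h2]

/-- The adversary for the hierarchical functions answers a query at `z` by choosing the subinterval
on the other side of `0`, which does not contain `z`. -/
lemma resists_tree (m : ℕ) : Resists tree (treeLevel 1 m) m {l | l.length = m} := by
  induction m with
  | zero => exact ⟨[], by ext l; simp⟩
  | succ m ih =>
    refine ⟨⟨List.replicate (m + 1) true, by simp, List.replicate (m + 1) false, by simp,
      by simp [List.replicate_succ]⟩, fun z => ?_⟩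
    obtain ⟨b, hb⟩ : ∃ b, |z - digitCtr b| = |z| + 1 / 2 := by
      rcases le_total 0 z with hz | hz
      · refine ⟨false, ?_⟩
        simp only [digitCtr, Bool.false_eq_true, if_false]
        rw [abs_of_nonneg hz, abs_of_nonneg (by linarith)]; ring
      · refine ⟨true, ?_⟩
        simp only [digitCtr, if_true]
        rw [abs_of_nonpos hz, abs_of_nonpos (by linarith)]; ring
    have hw : |4 * (z - digitCtr b)| = 4 * |z| + 2 := by
      rw [abs_mul, abs_of_pos (by norm_num : (0 : ℝ) < 4), hb]; ring
    have hz0 := abs_nonneg z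
    refine ⟨List.cons b '' {l | l.length = m}, ?_, ?_,
      treeStep z (|4 * (z - digitCtr b)|, absSlope (4 * (z - digitCtr b))), ?_, ?_, ?_⟩
    · rintro _ ⟨l, hl, rfl⟩
      simpa using hl
    · refine ih.cons b (fun z => 4 * (z - digitCtr b)) treeStep (fun _ _ => rfl) ?_ ?_
      · intro z p q h
        rw [treeStep_fst, treeStep_fst]
        exact max_le_max le_rfl (by linarith)
      · intro z p h
        rw [treeStep_fst]
        exact le_max_of_le_right (by simp only [treeLevel]; linarith)
    · rintro _ ⟨l, _, rfl⟩
      rw [tree, tree_of_one_le_abs l (by linarith)]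
    · intro l hl
      cases l with
      | nil => simp at hl
      | cons b' l =>
        rw [tree_cons_fst, treeStep_fst]
        refine max_le_max le_rfl ?_
        have h1 := tree_le_max l (4 * (z - digitCtr b'))
        have h2 : |4 * (z - digitCtr b')| ≤ |4 * (z - digitCtr b)| := by
          rw [abs_mul, abs_mul, hb, ← abs_digitCtr b']
          gcongr
          exact abs_sub _ _
        have h3 := h1.trans (max_le (by linarith) h2)
        simp only
        linarith
    · rw [treeStep_fst]
      refine le_max_of_le_right ?_
      have := treeLevel_le_one (le_refl 1) m
      simp only [treeLevel]
      linarith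

/-- The hierarchical functions of depth `m`. -/
noncomputable def treeProfile (m : ℕ) : Profile where
  φ := tree
  words := {l | l.length = m}
  ctr := treeCtr
  low := treeLevel 0 m
  tau := treeLevel (1 / 2) m
  sh := treeLevel 1 m
  rad := 1 / 2 / 4 ^ m
  rank := m
  sub := tree_sub
  abs_slope_le := abs_tree_snd_le
  val_le_one l z hz := (tree_le_max l z).trans (max_le le_rfl hz)
  neg_one_le_low := by linarith [treeLevel_nonneg (le_refl 0) m]
  low_le_tau := ((treeLevel_strictMono m) (by norm_num)).le
  tau_lt_sh := (treeLevel_strictMono m) (by norm_num)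
  sh_le_one := treeLevel_le_one le_rfl m
  rad_nonneg := by positivity
  val_ctr_le l hl := by
    have := (tree_ball l (z := treeCtr l) zero_lt_one le_rfl (by simp)).2
    rwa [show l.length = m from hl] at this
  ball l hl z hz := by
    have := tree_ball l (z := z) (r := 1 / 2) (by norm_num) (by norm_num)
      (by rwa [show l.length = m from hl])
    rwa [show l.length = m from hl] at this
  eq_of_lt l hl l' hl' z h h' :=
    tree_eq_of_lt ((show l.length = m from hl).trans (show l'.length = m from hl').symm)
      (by rwa [show l.length = m from hl]) (by rwa [show l'.length = m from hl'])
  resists := resists_tree m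

/-! ### The hidden function on the mixed-integer space -/

/-- The vertices of the unit cube, which index the relevant integer fibers. -/
abbrev Vertex (n : ℕ) : Type := Fin n → Bool

/-- The vertex as a point of `ℝⁿ`. -/
def vertexPt {n : ℕ} (v : Vertex n) : Fin n → ℝ := fun i => if v i then 1 else 0

/-- The affine function that vanishes at the vertex `v` and is minus the `ℓ₁` distance to `v` on
the unit cube. -/
def tilt {n : ℕ} (v : Vertex n) (x : Fin n → ℝ) : ℝ := ∑ i, if v i then x i - 1 else -x i

/-- The gradient of `tilt v`. -/
def tiltGrad {n : ℕ} (v : Vertex n) : Fin n → ℝ := fun i => if v i then 1 else -1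

/-- The hidden parameter: for every fiber the indices of the `d` one-dimensional functions, and
whether the fiber is deep, that is, whether low values are attained in it. -/
abbrev Param (n d : ℕ) : Type := (Vertex n → Fin d → List Bool) × (Vertex n → Bool)

/-- The value and gradient of one of the functions whose maximum is the hidden function: for every
fiber the `d` one-dimensional functions, and a constant (`none`) which cuts off the low levels
unless the fiber is deep. The tilt makes these functions irrelevant in the other fibers. -/
noncomputable def piece {n d : ℕ} (P : Profile) (R : ℝ) (θ : Param n d) (z : Space n d) :
    Vertex n × Option (Fin d) → ℝ × Space n d
  | (v, some i) => ((P.φ (θ.1 v i) (z.2 i / R)).1 + 2 * tilt v z.1,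
      ((2 : ℝ) • tiltGrad v, Pi.single i ((P.φ (θ.1 v i) (z.2 i / R)).2 / R)))
  | (v, none) => ((if θ.2 v then P.low else P.sh) + 2 * tilt v z.1, ((2 : ℝ) • tiltGrad v, 0))

/-- A linear preference among the pieces, used to break ties: the constants come last. -/
noncomputable def pieceOrder {n d : ℕ} (j : Vertex n × Option (Fin d)) : ℕ :=
  (if j.2 = none then Fintype.card (Vertex n × Option (Fin d)) else 0) +
    Fintype.equivFin (Vertex n × Option (Fin d)) j

section

variable {n d : ℕ}

lemma pieceOrder_some_lt (v v' : Vertex n) (i : Fin d) :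
    pieceOrder (v, some i) < pieceOrder (v', (none : Option (Fin d))) := by
  simp only [pieceOrder, reduceCtorEq, if_false, if_true, zero_add]
  exact (Fin.is_lt _).trans_le (Nat.le_add_right _ _)

lemma pieceOrder_injective :
    Function.Injective (pieceOrder : Vertex n × Option (Fin d) → ℕ) := by
  rintro ⟨v, o⟩ ⟨v', o'⟩ h
  refine (Fintype.equivFin (Vertex n × Option (Fin d))).injective (Fin.ext ?_)
  cases o <;> cases o'
  · simpa [pieceOrder] using h
  · exact absurd h (pieceOrder_some_lt _ _ _).ne'
  · exact absurd h (pieceOrder_some_lt _ _ _).ne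
  · simpa [pieceOrder] using h

/-- `j` is the preferred index among those at which `a` is maximal. -/
def IsFirstMax (a : Vertex n × Option (Fin d) → ℝ) (j : Vertex n × Option (Fin d)) : Prop :=
  ∀ k, a k ≤ a j ∧ (a k = a j → pieceOrder j ≤ pieceOrder k)

lemma exists_isFirstMax (a : Vertex n × Option (Fin d) → ℝ) : ∃ j, IsFirstMax a j := by
  classical
  obtain ⟨j₀, -, h₀⟩ := Finset.exists_max_image Finset.univ a Finset.univ_nonempty
  obtain ⟨j, hj, h⟩ := Finset.exists_min_image (Finset.univ.filter fun j => a j = a j₀) pieceOrder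
    ⟨j₀, by simp⟩
  have hj' : a j = a j₀ := by simpa using hj
  refine ⟨j, fun k => ⟨hj' ▸ h₀ k (Finset.mem_univ k), fun hk => h k ?_⟩⟩
  simpa using hk.trans hj'

lemma IsFirstMax.unique {a : Vertex n × Option (Fin d) → ℝ} {j k : Vertex n × Option (Fin d)}
    (hj : IsFirstMax a j) (hk : IsFirstMax a k) : j = k :=
  pieceOrder_injective <| le_antisymm
    ((hj k).2 (le_antisymm (hj k).1 (hk j).1)) ((hk j).2 (le_antisymm (hk j).1 (hj k).1))

/-- A first maximum persists when the other values decrease. -/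
lemma IsFirstMax.of_le {a b : Vertex n × Option (Fin d) → ℝ} {j : Vertex n × Option (Fin d)}
    (h : IsFirstMax a j) (hle : ∀ k, b k ≤ a k) (hj : b j = a j) : IsFirstMax b j :=
  fun k => ⟨hj ▸ (hle k).trans (h k).1, fun hk =>
    (h k).2 (le_antisymm (h k).1 (by rw [← hj, ← hk]; exact hle k))⟩

/-- The index of the piece that defines the hidden function at `z`. -/
noncomputable def leader (P : Profile) (R : ℝ) (θ : Param n d) (z : Space n d) :
    Vertex n × Option (Fin d) :=
  (exists_isFirstMax fun j => (piece P R θ z j).1).choose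

lemma isFirstMax_leader (P : Profile) (R : ℝ) (θ : Param n d) (z : Space n d) :
    IsFirstMax (fun j => (piece P R θ z j).1) (leader P R θ z) :=
  (exists_isFirstMax fun j => (piece P R θ z j).1).choose_spec

/-- The value and a subgradient of the hidden function, which is the maximum of all pieces. -/
noncomputable def hidden (P : Profile) (R : ℝ) (θ : Param n d) (z : Space n d) : ℝ × Space n d :=
  piece P R θ z (leader P R θ z)

lemma piece_le_hidden (P : Profile) (R : ℝ) (θ : Param n d) (z : Space n d)
    (j : Vertex n × Option (Fin d)) : (piece P R θ z j).1 ≤ (hidden P R θ z).1 :=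
  (isFirstMax_leader P R θ z j).1

lemma hidden_eq_of_isFirstMax {P : Profile} {R : ℝ} {θ : Param n d} {z : Space n d}
    {j : Vertex n × Option (Fin d)} (h : IsFirstMax (fun j => (piece P R θ z j).1) j) :
    hidden P R θ z = piece P R θ z j := by
  rw [hidden, (isFirstMax_leader P R θ z).unique h]

lemma tilt_add (v : Vertex n) (x x' : Fin n → ℝ) :
    tilt v x + ∑ i, tiltGrad v i * (x' - x) i = tilt v x' := by
  simp only [tilt, tiltGrad, ← Finset.sum_add_distrib]
  refine Finset.sum_congr rfl fun i _ => ?_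
  split_ifs <;> simp only [Pi.sub_apply] <;> ring

lemma piece_isSubgradient (P : Profile) (R : ℝ) (θ : Param n d) (z : Space n d)
    (j : Vertex n × Option (Fin d)) :
    IsSubgradient (fun z => (piece P R θ z j).1) z (piece P R θ z j).2 := by
  intro w
  have hx : ∑ i, ((2 : ℝ) • tiltGrad j.1) i * (w - z).1 i
      = 2 * ∑ i, tiltGrad j.1 i * (w.1 - z.1) i := by
    rw [Finset.mul_sum]
    exact Finset.sum_congr rfl fun i _ => by simp [mul_assoc]
  have ht := tilt_add j.1 z.1 w.1
  obtain ⟨v, _ | i⟩ := j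
  · simp only [piece, dot, Pi.zero_apply, zero_mul, Finset.sum_const_zero, add_zero]
    rw [hx]
    linarith
  · have h := P.sub (θ.1 v i) (z.2 i / R) (w.2 i / R)
    have hy : ∑ k, (Pi.single i ((P.φ (θ.1 v i) (z.2 i / R)).2 / R) : Fin d → ℝ) k * (w - z).2 k
        = (P.φ (θ.1 v i) (z.2 i / R)).2 * (w.2 i / R - z.2 i / R) := by
      rw [Finset.sum_eq_single i (fun k _ hk => by simp [hk]) (by simp)]
      simp
      ring
    simp only [piece, dot]
    rw [hx, hy]
    linarith

lemma hidden_isSubgradient (P : Profile) (R : ℝ) (θ : Param n d) (z : Space n d) :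
    IsSubgradient (fun z => (hidden P R θ z).1) z (hidden P R θ z).2 := fun w =>
  (piece_isSubgradient P R θ z (leader P R θ z) w).trans (piece_le_hidden P R θ w _)

lemma convexOn_hidden (P : Profile) (R : ℝ) (θ : Param n d) :
    ConvexOn ℝ Set.univ fun z => (hidden P R θ z).1 :=
  convexOn_of_isSubgradient fun z => ⟨_, hidden_isSubgradient P R θ z⟩

lemma continuous_hidden (P : Profile) (R : ℝ) (θ : Param n d) :
    Continuous fun z => (hidden P R θ z).1 := by
  simpa [continuousOn_univ] using (convexOn_hidden P R θ).continuousOn isOpen_univ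

lemma hidden_sub_le (P : Profile) {R : ℝ} (hR : 0 < R) (θ : Param n d) (x : Fin n → ℝ)
    (y y' : Fin d → ℝ) : (hidden P R θ (x, y)).1 - (hidden P R θ (x, y')).1 ≤ ‖y - y'‖ / R := by
  have h := hidden_isSubgradient P R θ (x, y) (x, y')
  have hb : -(‖y - y'‖ / R) ≤ dot (hidden P R θ (x, y)).2 ((x, y') - (x, y)) := by
    unfold hidden
    obtain ⟨v, _ | i⟩ := leader P R θ (x, y)
    · simp only [piece, dot, Prod.mk_sub_mk, sub_self, Pi.zero_apply, mul_zero, zero_mul,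
        Finset.sum_const_zero, add_zero]
      exact neg_nonpos.2 (by positivity)
    · simp only [piece, dot, Prod.mk_sub_mk, sub_self, Pi.zero_apply, mul_zero,
        Finset.sum_const_zero, zero_add]
      rw [Finset.sum_eq_single i (fun k _ hk => by simp [hk]) (by simp)]
      refine (neg_le_neg ?_).trans (neg_abs_le _)
      rw [Pi.single_eq_same, abs_mul, abs_div, abs_of_pos hR, div_mul_eq_mul_div]
      gcongr
      have h1 := norm_le_pi_norm (y - y') i
      rw [Real.norm_eq_abs, Pi.sub_apply, abs_sub_comm] at h1
      exact (mul_le_of_le_one_left (abs_nonneg _) (P.abs_slope_le _ _)).trans h1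
  simp only at h
  linarith

lemma tilt_vertexPt_self (v : Vertex n) : tilt v (vertexPt v) = 0 := by
  refine Finset.sum_eq_zero fun i _ => ?_
  by_cases h : v i <;> simp [vertexPt, h]

lemma tilt_vertexPt_le {v v' : Vertex n} (h : v' ≠ v) : tilt v' (vertexPt v) ≤ -1 := by
  obtain ⟨i, hi⟩ := Function.ne_iff.1 h
  have hle : ∀ k, (if v' k then vertexPt v k - 1 else -vertexPt v k) ≤ 0 := by
    intro k
    cases h1 : v' k <;> cases h2 : v k <;> simp [vertexPt, h2]
  have hi' : (if v' i then vertexPt v i - 1 else -vertexPt v i) = -1 := by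
    cases h1 : v' i <;> cases h2 : v i <;> simp_all [vertexPt]
  rw [tilt, ← Finset.add_sum_erase _ _ (Finset.mem_univ i), hi']
  linarith [Finset.sum_nonpos fun k (_ : k ∈ Finset.univ.erase i) => hle k]

/-- The hidden function on the fiber of a vertex is at most `a` as soon as the pieces of this
fiber are. -/
lemma hidden_vertex_le {P : Profile} {R a : ℝ} (hR : 0 < R) {θ : Param n d} {v : Vertex n}
    {y : Fin d → ℝ} (hy : ‖y‖ ≤ R) (ha : P.low ≤ a) (hc : (if θ.2 v then P.low else P.sh) ≤ a)
    (hφ : ∀ i, (P.φ (θ.1 v i) (y i / R)).1 ≤ a) : (hidden P R θ (vertexPt v, y)).1 ≤ a := by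
  unfold hidden
  have hl := P.low_le_tau
  have hs := P.tau_lt_sh
  have h1 := P.sh_le_one
  have h2 := P.neg_one_le_low
  obtain ⟨v', o⟩ := leader P R θ (vertexPt v, y)
  by_cases hv : v' = v
  · subst hv
    cases o <;> simp only [piece, tilt_vertexPt_self, mul_zero, add_zero]
    exacts [hc, hφ _]
  · have ht := tilt_vertexPt_le hv
    cases o with
    | none =>
      simp only [piece]
      split_ifs <;> linarith
    | some i =>
      simp only [piece]
      have := P.val_le_one (θ.1 v' i) (y i / R) (by
        rw [abs_div, abs_of_pos hR, div_le_one hR]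
        exact (norm_le_pi_norm y i).trans hy)
      linarith

lemma le_hidden_vertex (P : Profile) (R : ℝ) (θ : Param n d) (v : Vertex n) (y : Fin d → ℝ)
    (i : Fin d) : (P.φ (θ.1 v i) (y i / R)).1 ≤ (hidden P R θ (vertexPt v, y)).1 := by
  simpa [piece, tilt_vertexPt_self] using piece_le_hidden P R θ (vertexPt v, y) (v, some i)

lemma cutoff_le_hidden_vertex (P : Profile) (R : ℝ) (θ : Param n d) (v : Vertex n)
    (y : Fin d → ℝ) : (if θ.2 v then P.low else P.sh) ≤ (hidden P R θ (vertexPt v, y)).1 := by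
  simpa [piece, tilt_vertexPt_self] using piece_le_hidden P R θ (vertexPt v, y) (v, none)

end

/-! ### The adversary for the hidden function -/

section

variable {n d : ℕ}

/-- The parameters that the adversary keeps possible form a set `V` that leaves room for `r` more
queries: the indices of the one-dimensional functions range independently over sets `W v i`
that resist `k v i` queries, the vertices outside of `A` are known not to be deep, and a vertex is
known not to be deep only after all its one-dimensional functions are known. -/
def Survives (P : Profile) (r : ℕ) (V : Set (Param n d)) : Prop :=
  ∃ (k : Vertex n → Fin d → ℕ) (W : Vertex n → Fin d → Set (List Bool)) (A : Finset (Vertex n)),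
    r ≤ ∑ v, ∑ i, k v i + A.card ∧ (∀ v i, Resists P.φ P.sh (k v i) (W v i)) ∧
    (∀ v i, W v i ⊆ P.words) ∧ (∀ v i, 0 < k v i → v ∈ A) ∧
    V = {θ | (∀ v i, θ.1 v i ∈ W v i) ∧ ∀ v ∉ A, θ.2 v = false}

lemma survives_initial (P : Profile) :
    Survives P (2 ^ n * (d * P.rank + 1)) {θ : Param n d | ∀ v i, θ.1 v i ∈ P.words} := by
  refine ⟨fun _ _ => P.rank, fun _ _ => P.words, Finset.univ, ?_, fun _ _ => P.resists,
    fun _ _ => subset_rfl, fun _ _ _ => Finset.mem_univ _, by simp⟩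
  simp [mul_add]

lemma Survives.nonempty {P : Profile} {r : ℕ} {V : Set (Param n d)} (h : Survives P r V) :
    V.Nonempty := by
  obtain ⟨k, W, A, -, hW, -, -, rfl⟩ := h
  choose q hq using fun v i => (hW v i).nonempty
  exact ⟨(q, fun _ => false), hq, fun _ _ => rfl⟩

/-- The adversary for the hidden function: for every piece consider the largest value that it may
have at `z`, and answer with the largest of these values, revealing at most one digit. -/
lemma Survives.step {P : Profile} {r : ℕ} {R : ℝ} {V : Set (Param n d)}
    (h : Survives P (r + 1) V) (z : Space n d) :
    ∃ V' ⊆ V, Survives P r V' ∧ ∃ w, ∀ θ ∈ V', hidden P R θ z = w := by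
  classical
  obtain ⟨k, W, A, hr, hW, hwords, hA, rfl⟩ := h
  choose W' hW'sub hW' w hw hle hfl using fun v i => (hW v i).step (z.2 i / R)
  have hlow : P.low ≤ P.sh := P.low_le_tau.trans P.tau_lt_sh.le
  -- the largest possible values of the pieces
  let u : Vertex n × Option (Fin d) → ℝ := fun j => match j with
    | (v, some i) => (w v i).1 + 2 * tilt v z.1
    | (v, none) => P.sh + 2 * tilt v z.1
  have hu : ∀ θ : Param n d, (∀ v i, θ.1 v i ∈ W v i) → ∀ j, (piece P R θ z j).1 ≤ u j := by
    rintro θ hθ ⟨v, _ | i⟩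
    · simp only [piece, u]
      split_ifs <;> linarith
    · simp only [piece, u]
      linarith [hle v i _ (hθ v i)]
  obtain ⟨⟨v₀, _ | i₀⟩, hj⟩ := exists_isFirstMax u
  · -- the constant of the fiber of `v₀` is revealed
    have hk : ∀ i, k v₀ i = 0 := by
      intro i
      by_contra hi
      have h1 := hfl v₀ i (Nat.pos_of_ne_zero hi)
      have h2 := hj (v₀, some i)
      have h3 : u (v₀, some i) = u (v₀, none) :=
        le_antisymm h2.1 (by simp only [u]; linarith)
      exact absurd (h2.2 h3) (not_le.2 (pieceOrder_some_lt v₀ v₀ i))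
    refine ⟨{θ | (∀ v i, θ.1 v i ∈ W v i) ∧ ∀ v ∉ A.erase v₀, θ.2 v = false}, ?_,
      ⟨k, W, A.erase v₀, ?_, hW, hwords, ?_, rfl⟩,
      (P.sh + 2 * tilt v₀ z.1, ((2 : ℝ) • tiltGrad v₀, 0)), ?_⟩
    · exact fun θ hθ => ⟨hθ.1, fun v hv => hθ.2 v fun h => hv (Finset.mem_of_mem_erase h)⟩
    · have := Finset.pred_card_le_card_erase (s := A) (a := v₀)
      omega
    · intro v i hvi
      refine Finset.mem_erase.2 ⟨?_, hA v i hvi⟩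
      rintro rfl
      exact hvi.ne' (hk i)
    · intro θ hθ
      have h0 : θ.2 v₀ = false := hθ.2 v₀ (by simp)
      have hv : (piece P R θ z (v₀, none)).1 = u (v₀, none) := by simp [piece, u, h0]
      rw [hidden_eq_of_isFirstMax (hj.of_le (hu θ hθ.1) hv)]
      simp [piece, h0]
  · -- a digit of the function with index `(v₀, i₀)` is revealed
    let W₁ : Vertex n → Fin d → Set (List Bool) := fun v i =>
      if v = v₀ ∧ i = i₀ then W' v i else W v i
    let k₁ : Vertex n → Fin d → ℕ := fun v i => if v = v₀ ∧ i = i₀ then k v i - 1 else k v i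
    have hW₁ : ∀ v i, W₁ v i ⊆ W v i := by
      intro v i
      simp only [W₁]
      split_ifs
      exacts [hW'sub v i, subset_rfl]
    have hk₁ : ∀ v i, k₁ v i ≤ k v i := by
      intro v i
      simp only [k₁]
      split_ifs <;> omega
    refine ⟨{θ | (∀ v i, θ.1 v i ∈ W₁ v i) ∧ ∀ v ∉ A, θ.2 v = false}, ?_,
      ⟨k₁, W₁, A, ?_, ?_, fun v i => (hW₁ v i).trans (hwords v i),
        fun v i hvi => hA v i (hvi.trans_le (hk₁ v i)), rfl⟩,
      ((w v₀ i₀).1 + 2 * tilt v₀ z.1,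
        ((2 : ℝ) • tiltGrad v₀, Pi.single i₀ ((w v₀ i₀).2 / R))), ?_⟩
    · exact fun θ hθ => ⟨fun v i => hW₁ v i (hθ.1 v i), hθ.2⟩
    · have hsum : ∑ v, ∑ i, k v i ≤ ∑ v, ∑ i, k₁ v i + 1 := by
        have h1 : ∀ v i, k v i ≤ k₁ v i + if v = v₀ ∧ i = i₀ then 1 else 0 := by
          intro v i
          simp only [k₁]
          split_ifs <;> omega
        refine (Finset.sum_le_sum fun v _ => Finset.sum_le_sum fun i _ => h1 v i).trans ?_
        simp only [Finset.sum_add_distrib, ite_and]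
        simp
      omega
    · intro v i
      simp only [W₁, k₁]
      split_ifs
      exacts [hW' v i, hW v i]
    · intro θ hθ
      have h0 : P.φ (θ.1 v₀ i₀) (z.2 i₀ / R) = w v₀ i₀ :=
        hw v₀ i₀ _ (by simpa [W₁] using hθ.1 v₀ i₀)
      have hv : (piece P R θ z (v₀, some i₀)).1 = u (v₀, some i₀) := by simp [piece, u, h0]
      rw [hidden_eq_of_isFirstMax (hj.of_le (hu θ fun v i => hW₁ v i (hθ.1 v i)) hv)]
      simp [piece, h0]

/-- The parameters in which `v` is the only deep vertex. -/
def OnlyDeep (P : Profile) (θ : Param n d) (v : Vertex n) : Prop :=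
  (∀ v i, θ.1 v i ∈ P.words) ∧ ∀ v', θ.2 v' = true ↔ v' = v

/-- With room for two queries there are two possible parameters with one deep vertex each that
differ in their deep fibers. -/
lemma Survives.exists_pair {P : Profile} {r : ℕ} {V : Set (Param n d)} (h : Survives P r V)
    (hr : 2 ≤ r) : ∃ θ₁ ∈ V, ∃ θ₂ ∈ V, ∃ v₁ v₂, OnlyDeep P θ₁ v₁ ∧ OnlyDeep P θ₂ v₂ ∧
      (v₁ = v₂ → θ₁.1 v₁ ≠ θ₂.1 v₂) := by
  classical
  obtain ⟨k, W, A, hsum, hW, hwords, hA, rfl⟩ := h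
  choose q hq using fun v i => (hW v i).nonempty
  have hmem : ∀ (q : Vertex n → Fin d → List Bool), (∀ v i, q v i ∈ W v i) → ∀ v ∈ A,
      (q, fun v' => decide (v' = v)) ∈
          {θ : Param n d | (∀ v i, θ.1 v i ∈ W v i) ∧ ∀ v ∉ A, θ.2 v = false} ∧
        OnlyDeep P ((q, fun v' => decide (v' = v)) : Param n d) v := by
    refine fun q hq v hv => ⟨⟨hq, fun v' hv' => ?_⟩, fun v i => hwords v i (hq v i), by simp⟩
    simp only [decide_eq_false_iff_not]
    rintro rfl
    exact hv' hv
  by_cases hk : ∃ v i, 0 < k v i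
  · obtain ⟨v, i, hvi⟩ := hk
    have hnt : (W v i).Nontrivial := by
      have := hW v i
      obtain ⟨m, hm⟩ := Nat.exists_eq_add_of_lt hvi
      rw [hm] at this
      exact this.1
    obtain ⟨l, hl, hne⟩ := hnt.exists_ne (q v i)
    let q' : Vertex n → Fin d → List Bool := fun v' i' => if v' = v ∧ i' = i then l else q v' i'
    have hq' : ∀ v i, q' v i ∈ W v i := by
      intro v' i'
      simp only [q']
      split_ifs with h
      · rw [h.1, h.2]; exact hl
      · exact hq v' i'
    obtain ⟨h1, h2⟩ := hmem q hq v (hA v i hvi)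
    obtain ⟨h3, h4⟩ := hmem q' hq' v (hA v i hvi)
    refine ⟨_, h1, _, h3, v, v, h2, h4, fun _ heq => hne ?_⟩
    simpa [q'] using (congrFun heq i).symm
  · push Not at hk
    have h0 : ∑ v, ∑ i, k v i = 0 :=
      Finset.sum_eq_zero fun v _ => Finset.sum_eq_zero fun i _ => Nat.le_zero.1 (hk v i)
    obtain ⟨v₁, hv₁, v₂, hv₂, hne⟩ := Finset.one_lt_card.1 (show 1 < A.card by omega)
    obtain ⟨h1, h2⟩ := hmem q hq v₁ hv₁
    obtain ⟨h3, h4⟩ := hmem q hq v₂ hv₂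
    exact ⟨_, h1, _, h3, v₁, v₂, h2, h4, fun h => absurd h hne⟩

lemma OnlyDeep.eq_of_hidden_lt {P : Profile} {R : ℝ} {θ : Param n d} {v v' : Vertex n}
    {y : Fin d → ℝ} (h : OnlyDeep P θ v) (hz : (hidden P R θ (vertexPt v', y)).1 < P.sh) :
    v' = v := by
  have hc := (cutoff_le_hidden_vertex P R θ v' y).trans_lt hz
  by_contra hv
  rw [if_neg (fun hd => hv ((h.2 v').1 hd))] at hc
  exact lt_irrefl _ hc

/-- Parameters that differ in their deep fibers have no common point of low value. -/
lemma OnlyDeep.not_common {P : Profile} {R : ℝ} {θ₁ θ₂ : Param n d} {v₁ v₂ : Vertex n}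
    (h₁ : OnlyDeep P θ₁ v₁) (h₂ : OnlyDeep P θ₂ v₂) (hne : v₁ = v₂ → θ₁.1 v₁ ≠ θ₂.1 v₂)
    (v : Vertex n) (y : Fin d → ℝ) (hz₁ : (hidden P R θ₁ (vertexPt v, y)).1 < P.sh)
    (hz₂ : (hidden P R θ₂ (vertexPt v, y)).1 < P.sh) : False := by
  obtain rfl := h₁.eq_of_hidden_lt hz₁
  obtain rfl := h₂.eq_of_hidden_lt hz₂
  refine hne rfl (funext fun i => ?_)
  exact P.eq_of_lt _ (h₁.1 v i) _ (h₂.1 v i) (y i / R)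
    ((le_hidden_vertex P R θ₁ v y i).trans_lt hz₁) ((le_hidden_vertex P R θ₂ v y i).trans_lt hz₂)

end

/-! ### From adversaries to information complexity -/

section

/-- An adversary that maintains a set of possible parameters leads to parameters which a given
strategy cannot distinguish. -/
lemma exists_indistinguishable {Inst Θ : Type} (O : Oracle Inst) (D : O.Strategy) (inst : Θ → Inst)
    (S : ℕ → Set Θ → Prop) (hne : ∀ r V, S r V → V.Nonempty)
    (hstep : ∀ r V, S (r + 1) V → ∀ q, ∃ V' ⊆ V, S r V' ∧
      ∀ θ ∈ V', ∀ θ' ∈ V', O.answer q (inst θ) = O.answer q (inst θ'))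
    (k r : ℕ) (V : Set Θ) (hV : S (r + k) V) :
    ∃ V' ⊆ V, S r V' ∧ ∀ θ ∈ V', ∀ θ' ∈ V',
      O.transcript D (inst θ) k = O.transcript D (inst θ') k ∧
      ∀ i < k, O.answer (O.query D (inst θ) i) (inst θ') =
        O.answer (O.query D (inst θ) i) (inst θ) := by
  induction k generalizing r with
  | zero => exact ⟨V, subset_rfl, hV, fun _ _ _ _ => ⟨rfl, fun i hi => absurd hi i.not_lt_zero⟩⟩
  | succ k ih =>
    obtain ⟨V₁, hV₁, hS₁, h₁⟩ := ih (r + 1) (by rwa [add_assoc, add_comm 1 k])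
    obtain ⟨θ₀, hθ₀⟩ := hne _ _ hS₁
    obtain ⟨V₂, hV₂, hS₂, h₂⟩ := hstep r V₁ hS₁ (O.query D (inst θ₀) k)
    have hq : ∀ θ ∈ V₂, O.query D (inst θ) k = O.query D (inst θ₀) k := fun θ hθ => by
      rw [Oracle.query, Oracle.query, (h₁ θ (hV₂ hθ) θ₀ hθ₀).1]
    refine ⟨V₂, hV₂.trans hV₁, hS₂, fun θ hθ θ' hθ' => ⟨?_, fun i hi => ?_⟩⟩
    · have ht := (h₁ θ (hV₂ hθ) θ' (hV₂ hθ')).1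
      have ha := h₂ θ hθ θ' hθ'
      rw [← hq θ hθ, Oracle.query] at ha
      rw [Oracle.transcript, Oracle.transcript, ha, ht]
    · rcases Nat.lt_succ_iff_lt_or_eq.1 hi with hi | rfl
      · exact (h₁ θ (hV₂ hθ) θ' (hV₂ hθ')).2 i hi
      · rw [hq θ hθ]
        exact h₂ θ' hθ' θ hθ

lemma le_icomp {n d : ℕ} {ε : ℝ} {𝓘 : Set (Instance n d)} {O : Oracle (Instance n d)} {N : ℕ}
    (h : ∀ D : O.Strategy, ∃ I ∈ 𝓘, ∃ J ∈ 𝓘,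
      (∀ i < N, O.answer (O.query D I i) J = O.answer (O.query D I i) I) ∧
        ∀ z, z ∈ I.approxSolutions ε → z ∉ J.approxSolutions ε) :
    ((N + 1 : ℕ) : ℕ∞) ≤ icomp ε 𝓘 O := by
  refine le_iInf fun D => ?_
  obtain ⟨I, hI, J, hJ, hIJ, hdisj⟩ := h D
  refine le_iSup₂_of_le I hI (le_iInf₂ fun k hk => ?_)
  obtain ⟨z, hz⟩ := hk
  rw [Nat.cast_le]
  by_contra! hkN
  exact hdisj z (hz I hI fun _ _ => rfl) (hz J hJ fun i hi => hIJ i (by omega))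

end

/-! ### Charts with prescribed answers -/

section

variable {n d : ℕ}

/-- `g` separates `z` from `C` and is normalized. -/
def Separates (C : Set (Space n d)) (z g : Space n d) : Prop :=
  (∀ z' ∈ C, dot g z' < dot g z) ∧ dot g g = 1

/-- Valid answers may be prescribed for any injective family of instances; all other instances are
answered arbitrarily. -/
lemma exists_chart {Ω : Type} {R ρ M : ℝ} (inst : Ω → Instance n d)
    (hinj : Function.Injective inst) (sepRule subRule : Ω → Space n d → Space n d)
    (hsub : ∀ ω, ∀ z ∈ box n d R, IsSubgradient (inst ω).f z (subRule ω z))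
    (hsep_mem : ∀ ω, ∀ z ∈ (inst ω).C, sepRule ω z = 0)
    (hsep : ∀ ω, inst ω ∈ instanceClass n d R ρ M → ∀ z ∈ box n d R, z ∉ (inst ω).C →
      Separates (inst ω).C z (sepRule ω z)) :
    ∃ G : FirstOrderChart n d R ρ M, ∀ ω z, G.val z (inst ω) = (inst ω).f z.1 ∧
      G.sub z (inst ω) = subRule ω z.1 ∧ G.sep z (inst ω) = sepRule ω z.1 := by
  classical
  let sep₀ : Space n d → Instance n d → Space n d := fun z I =>
    if z ∈ I.C then 0 else Classical.epsilon (Separates I.C z)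
  let sub₀ : Space n d → Instance n d → Space n d := fun z I =>
    Classical.epsilon (IsSubgradient I.f z)
  have key : ∀ (z : box n d R), ∀ I ∈ instanceClass n d R ρ M, z.1 ∉ I.C →
      Separates I.C z.1 (Function.extend inst (fun ω => sepRule ω z.1) (sep₀ z.1) I) := by
    intro z I hI hz
    by_cases h : ∃ ω, inst ω = I
    · obtain ⟨ω, rfl⟩ := h
      rw [hinj.extend_apply]
      exact hsep ω hI z.1 z.2 hz
    · rw [Function.extend_apply' _ _ _ h]
      simp only [sep₀, if_neg hz]
      obtain ⟨w, hw⟩ := hI.feasible_nonempty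
      exact Classical.epsilon_spec (exists_separating I.convex_C I.closed_C ⟨w, hw.1⟩ hz)
  let G : FirstOrderChart n d R ρ M :=
  { sep := fun z => Function.extend inst (fun ω => sepRule ω z.1) (sep₀ z.1)
    val := fun z I => I.f z.1
    sub := fun z => Function.extend inst (fun ω => subRule ω z.1) (sub₀ z.1)
    sep_of_mem := by
      intro z I hI hz
      by_cases h : ∃ ω, inst ω = I
      · obtain ⟨ω, rfl⟩ := h
        rw [hinj.extend_apply]
        exact hsep_mem ω z.1 hz
      · rw [Function.extend_apply' _ _ _ h]
        exact if_pos hz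
    sep_of_notMem := fun z I hI hz => (key z I hI hz).1
    sep_normalized := fun z I hI hz => (key z I hI hz).2
    val_eq := fun _ _ _ => rfl
    sub_isSubgradient := by
      intro z I hI
      by_cases h : ∃ ω, inst ω = I
      · obtain ⟨ω, rfl⟩ := h
        rw [hinj.extend_apply]
        exact hsub ω z.1 z.2
      · rw [Function.extend_apply' _ _ _ h]
        exact Classical.epsilon_spec (exists_isSubgradient I.convex_f z.1) }
  exact ⟨G, fun ω z => ⟨rfl, hinj.extend_apply (fun ω => subRule ω z.1) (sub₀ z.1) ω,
    hinj.extend_apply (fun ω => sepRule ω z.1) (sep₀ z.1) ω⟩⟩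

end

/-! ### The hard instances -/

section

variable {n d : ℕ}

/-- The product of the unit cube and `[-R, R]^d`. -/
def slab (n d : ℕ) (R : ℝ) : Set (Space n d) := {z | (∀ i, z.1 i ∈ Set.Icc (0 : ℝ) 1) ∧ ‖z.2‖ ≤ R}

lemma isClosed_slab (R : ℝ) : IsClosed (slab n d R) := by
  have h1 : IsClosed {z : Space n d | ∀ i, z.1 i ∈ Set.Icc (0 : ℝ) 1} := by
    simp only [Set.ofPred_forall]
    exact isClosed_iInter fun i =>
      isClosed_Icc.preimage ((continuous_apply i).comp continuous_fst)
  exact h1.inter (isClosed_le continuous_snd.norm continuous_const)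

lemma convex_slab (R : ℝ) : Convex ℝ (slab n d R) := by
  intro z hz w hw a b ha hb hab
  refine ⟨fun i => convex_Icc (0 : ℝ) 1 (hz.1 i) (hw.1 i) ha hb hab, ?_⟩
  have h := convex_closedBall (0 : Fin d → ℝ) R (by simpa using hz.2) (by simpa using hw.2)
    ha hb hab
  simpa using h

lemma slab_subset_box {R : ℝ} (hR : 1 ≤ R) : slab n d R ⊆ box n d R := by
  intro z hz
  refine max_le ((pi_norm_le_iff_of_nonneg (by linarith)).2 fun i => ?_) hz.2
  have := hz.1 i
  rw [Real.norm_eq_abs, abs_of_nonneg this.1]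
  exact this.2.trans hR

/-- The two ways to hide a function: in the objective, with a known feasible region, or in the
feasible region, as the set of points of level at most `P.tau`. -/
def region (P : Profile) (R : ℝ) (inObjective : Bool) (θ : Param n d) : Set (Space n d) :=
  if inObjective then slab n d R else slab n d R ∩ {z | (hidden P R θ z).1 ≤ P.tau}

/-- The objective function on the box `[-R, R]^{n+d}`. -/
noncomputable def objective (P : Profile) (R M : ℝ) (inObjective : Bool) (θ : Param n d)
    (z : Space n d) : ℝ :=
  if inObjective then M * R * (hidden P R θ z).1 else 0

/-- The subgradients of the objective function that are used as answers. -/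
noncomputable def objectiveGrad (P : Profile) (R M : ℝ) (inObjective : Bool) (θ : Param n d)
    (z : Space n d) : Space n d :=
  if inObjective then (M * R) • (hidden P R θ z).2 else 0

lemma region_subset_slab (P : Profile) (R : ℝ) (b : Bool) (θ : Param n d) :
    region P R b θ ⊆ slab n d R := by
  cases b
  · exact Set.inter_subset_left
  · exact subset_rfl

lemma isClosed_region (P : Profile) (R : ℝ) (b : Bool) (θ : Param n d) :
    IsClosed (region P R b θ) := by
  cases b
  · exact (isClosed_slab R).inter (isClosed_le (continuous_hidden P R θ) continuous_const)
  · exact isClosed_slab R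

lemma convex_region (P : Profile) (R : ℝ) (b : Bool) (θ : Param n d) :
    Convex ℝ (region P R b θ) := by
  cases b
  · have h := (convexOn_hidden P R θ).convex_le P.tau
    simp only [Set.mem_univ, true_and] at h
    exact (convex_slab R).inter h
  · exact convex_slab R

lemma objectiveGrad_isSubgradient (P : Profile) {R M : ℝ} (hMR : 0 ≤ M * R) (b : Bool)
    (θ : Param n d) (z : Space n d) :
    IsSubgradient (objective P R M b θ) z (objectiveGrad P R M b θ z) := by
  intro w
  cases b
  · simp [objective, objectiveGrad, zero_dot]
  · have h := mul_le_mul_of_nonneg_left (hidden_isSubgradient P R θ z w) hMR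
    simp only [objective, objectiveGrad, if_true, smul_dot]
    linarith

/-- A convex function that vanishes on the box `[-R, R]^{n+d}`, so that adding a multiple of it to
the objective does not affect any answer. -/
noncomputable def outside (R : ℝ) (z : Space n d) : ℝ := max 0 (‖z‖ - R)

lemma outside_nonneg (R : ℝ) (z : Space n d) : 0 ≤ outside R z := le_max_left _ _

lemma outside_of_mem {R : ℝ} {z : Space n d} (hz : z ∈ box n d R) : outside R z = 0 :=
  max_eq_left (sub_nonpos.2 hz)

lemma convexOn_outside (R : ℝ) : ConvexOn ℝ Set.univ (outside R : Space n d → ℝ) :=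
  (convexOn_const 0 convex_univ).sup (convexOn_univ_norm.sub (concaveOn_const R convex_univ))

/-- The hard instance with parameter `θ`. The coefficient `c` is not visible to queries in the box;
it serves to make different parameters have different instances. -/
noncomputable def hardInstance (P : Profile) {R M : ℝ} (hMR : 0 ≤ M * R) (b : Bool)
    (θ : Param n d) (c : NNReal) : Instance n d where
  f z := objective P R M b θ z + c * outside R z
  C := region P R b θ
  convex_f := (convexOn_of_isSubgradient fun z =>
    ⟨_, objectiveGrad_isSubgradient P hMR b θ z⟩).add ((convexOn_outside R).smul c.2)
  closed_C := isClosed_region P R b θ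
  convex_C := convex_region P R b θ

lemma hardInstance_f_of_mem (P : Profile) {R M : ℝ} (hMR : 0 ≤ M * R) (b : Bool)
    (θ : Param n d) (c : NNReal) {z : Space n d} (hz : z ∈ box n d R) :
    (hardInstance P hMR b θ c).f z = objective P R M b θ z := by
  simp [hardInstance, outside_of_mem hz]

/-- Countably many real numbers can be made pairwise distinct by adding nonnegative numbers. -/
lemma exists_injective_add {Ω : Type} [Countable Ω] (u : Ω → ℝ) :
    ∃ c : Ω → NNReal, Function.Injective fun ω => u ω + c ω := by
  obtain ⟨e, he⟩ := exists_injective_nat Ω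
  have h : ∀ ω, 0 ≤ (Nat.pair ⌈u ω⌉₊ (e ω) : ℝ) - u ω := fun ω =>
    sub_nonneg.2 ((Nat.le_ceil _).trans (by exact_mod_cast Nat.left_le_pair _ _))
  refine ⟨fun ω => ⟨_, h ω⟩, fun ω ω' hω => he ?_⟩
  have h' : (Nat.pair ⌈u ω⌉₊ (e ω) : ℝ) = Nat.pair ⌈u ω'⌉₊ (e ω') := by
    have h₁ : u ω + ((Nat.pair ⌈u ω⌉₊ (e ω) : ℝ) - u ω) =
        u ω' + ((Nat.pair ⌈u ω'⌉₊ (e ω') : ℝ) - u ω') := hω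
    linarith
  exact (Nat.pair_eq_pair.1 (by exact_mod_cast h')).2

lemma exists_injective_hardInstance {Λ : Type} [Countable Λ] (P : Λ → Profile) {R M : ℝ}
    (hMR : 0 ≤ M * R) (hR : 0 ≤ R) (hnd : 1 ≤ n + d) :
    ∃ c : Λ × Bool × Param n d → NNReal,
      Function.Injective fun ω : Λ × Bool × Param n d =>
        hardInstance (P ω.1) hMR ω.2.1 ω.2.2 (c ω) := by
  let far : Space n d := (fun _ => R + 1, fun _ => R + 1)
  have hfar : outside R far = 1 := by
    have hnorm : ‖far‖ = R + 1 := by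
      have hb : ‖R + 1‖ = R + 1 := by rw [Real.norm_eq_abs, abs_of_nonneg (by linarith)]
      have h1 : ∀ k, ‖(fun _ : Fin k => R + 1)‖ ≤ R + 1 := fun k =>
        (pi_norm_const_le _).trans_eq hb
      refine le_antisymm (max_le (h1 n) (h1 d)) ?_
      rcases Nat.eq_zero_or_pos n with h | h
      · have : Nonempty (Fin d) := ⟨⟨0, by omega⟩⟩
        exact le_max_of_le_right ((pi_norm_const (ι := Fin d) (R + 1)).trans hb).ge
      · have : Nonempty (Fin n) := ⟨⟨0, h⟩⟩
        exact le_max_of_le_left ((pi_norm_const (ι := Fin n) (R + 1)).trans hb).ge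
    rw [outside, hnorm]
    norm_num
  obtain ⟨c, hc⟩ := exists_injective_add fun ω : Λ × Bool × Param n d =>
    objective (P ω.1) R M ω.2.1 ω.2.2 far
  refine ⟨c, fun ω ω' h => hc ?_⟩
  have := congrFun (congrArg Instance.f h) far
  simpa [hardInstance, hfar] using this

lemma exists_eq_vertexPt {R : ℝ} {z : Space n d} (hz : z ∈ slab n d R)
    (hint : z ∈ mixedInteger n d) : ∃ v y, ‖y‖ ≤ R ∧ z = (vertexPt v, y) := by
  refine ⟨fun i => decide (z.1 i = 1), z.2, hz.2, Prod.ext (funext fun i => ?_) rfl⟩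
  obtain ⟨k, hk⟩ := hint i
  have h := hz.1 i
  rw [hk, Set.mem_Icc] at h
  have h0 : 0 ≤ k := by exact_mod_cast h.1
  have h1 : k ≤ 1 := by exact_mod_cast h.2
  simp only [vertexPt, hk]
  interval_cases k <;> simp

lemma vertexPt_mem_slab {R : ℝ} (v : Vertex n) {y : Fin d → ℝ} (hy : ‖y‖ ≤ R) :
    (vertexPt v, y) ∈ slab n d R := by
  refine ⟨fun i => ?_, hy⟩
  simp only [vertexPt]
  split_ifs <;> simp

lemma vertexPt_mem_mixedInteger (v : Vertex n) (y : Fin d → ℝ) :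
    (vertexPt v, y) ∈ mixedInteger n d := by
  intro i
  by_cases h : v i
  · exact ⟨1, by simp [vertexPt, h]⟩
  · exact ⟨0, by simp [vertexPt, h]⟩

/-- The deep fiber contains an `ℓ_∞` ball of radius `R * P.rad` of points of level at most
`P.tau`. -/
lemma OnlyDeep.ball {P : Profile} {R : ℝ} (hR : 0 < R) {θ : Param n d} {v : Vertex n}
    (h : OnlyDeep P θ v) {y : Fin d → ℝ} (hy : ‖y - fun i => R * P.ctr (θ.1 v i)‖ ≤ R * P.rad) :
    ‖y‖ ≤ R ∧ (hidden P R θ (vertexPt v, y)).1 ≤ P.tau := by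
  have hb : ∀ i, |y i / R| ≤ 1 ∧ (P.φ (θ.1 v i) (y i / R)).1 ≤ P.tau := by
    intro i
    refine P.ball _ (h.1 v i) _ ?_
    have h1 := (norm_le_pi_norm _ i).trans hy
    have h2 : y i / R - P.ctr (θ.1 v i) = (y i - R * P.ctr (θ.1 v i)) / R := by field_simp
    rw [h2, abs_div, abs_of_pos hR, div_le_iff₀ hR, mul_comm P.rad]
    exact h1
  have hyR : ‖y‖ ≤ R := (pi_norm_le_iff_of_nonneg hR.le).2 fun i => by
    have := (hb i).1
    rwa [abs_div, abs_of_pos hR, div_le_one hR] at this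
  refine ⟨hyR, hidden_vertex_le hR hyR P.low_le_tau ?_ fun i => (hb i).2⟩
  rw [if_pos ((h.2 v).2 rfl)]
  exact P.low_le_tau

/-- The deep fiber contains a point of level `P.low`. -/
lemma OnlyDeep.exists_low {P : Profile} {R : ℝ} (hR : 0 < R) {θ : Param n d} {v : Vertex n}
    (h : OnlyDeep P θ v) :
    ∃ y : Fin d → ℝ, ‖y‖ ≤ R ∧ (hidden P R θ (vertexPt v, y)).1 ≤ P.low ∧
      (hidden P R θ (vertexPt v, y)).1 ≤ P.tau := by
  have hc := h.ball hR (y := fun i => R * P.ctr (θ.1 v i))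
    (by simpa using mul_nonneg hR.le P.rad_nonneg)
  refine ⟨_, hc.1, hidden_vertex_le hR hc.1 le_rfl ?_ fun i => ?_, hc.2⟩
  · rw [if_pos ((h.2 v).2 rfl)]
  · rw [mul_div_cancel_left₀ _ hR.ne']
    exact P.val_ctr_le _ (h.1 v i)

lemma OnlyDeep.isInClass {P : Profile} {R ρ M : ℝ} (hR : 1 ≤ R) (hM : 0 < M) (hρR : ρ ≤ R)
    (hMR : 0 ≤ M * R) {b : Bool} (hb : b = false → ρ ≤ R * P.rad) {θ : Param n d} {v : Vertex n}
    (h : OnlyDeep P θ v) (c : NNReal) : IsInClass R ρ M (hardInstance P hMR b θ c) where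
  feasible_nonempty := by
    obtain ⟨y, hy, -, ht⟩ := h.exists_low (R := R) (by linarith)
    refine ⟨(vertexPt v, y), ?_, vertexPt_mem_mixedInteger v y⟩
    cases b
    · exact ⟨vertexPt_mem_slab v hy, ht⟩
    · exact vertexPt_mem_slab v hy
  subset_box := (region_subset_slab P R b θ).trans (slab_subset_box hR)
  deep_fiber z hz := by
    obtain ⟨v', y, hy, rfl⟩ := exists_eq_vertexPt (region_subset_slab P R b θ hz.1.1) hz.1.2
    cases b
    · obtain rfl := h.eq_of_hidden_lt (hz.1.1.2.trans_lt P.tau_lt_sh)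
      refine ⟨fun i => R * P.ctr (θ.1 v' i), fun y' hy' => ?_⟩
      obtain ⟨h1, h2⟩ := h.ball (by linarith) (hy'.trans (hb rfl))
      exact ⟨vertexPt_mem_slab v' h1, h2⟩
    · refine ⟨0, fun y' hy' => vertexPt_mem_slab v' ?_⟩
      rw [sub_zero] at hy'
      exact hy'.trans hρR
  lipschitz x y y' _ hx hy hy' := by
    rw [hardInstance_f_of_mem _ _ _ _ _ (max_le hx hy),
      hardInstance_f_of_mem _ _ _ _ _ (max_le hx hy')]
    cases b
    · simp only [objective, Bool.false_eq_true, if_false, sub_self, abs_zero]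
      positivity
    · simp only [objective, if_true]
      have hR0 : 0 < R := by linarith
      have h1 := hidden_sub_le P hR0 θ x y y'
      have h2 := hidden_sub_le P hR0 θ x y' y
      rw [norm_sub_rev] at h2
      rw [← mul_sub, abs_mul, abs_of_nonneg hMR, mul_assoc]
      gcongr
      rw [← le_div_iff₀' hR0, abs_le]
      constructor <;> linarith

/-- Approximate solutions lie in fibers of vertices and have a level below `P.sh`. -/
lemma OnlyDeep.approx {P : Profile} {R M ε : ℝ} (hR : 1 ≤ R) (hMR : 0 ≤ M * R)
    {b : Bool} (hb : b = true → M * R * P.low + ε < M * R * P.sh) {θ : Param n d} {v : Vertex n}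
    (h : OnlyDeep P θ v) (c : NNReal) {z : Space n d}
    (hz : z ∈ (hardInstance P hMR b θ c).approxSolutions ε) :
    ∃ v' y, z = (vertexPt v', y) ∧ (hidden P R θ z).1 < P.sh := by
  have hslab := region_subset_slab P R b θ hz.1.1
  obtain ⟨v', y, hy, rfl⟩ := exists_eq_vertexPt hslab hz.1.2
  refine ⟨v', y, rfl, ?_⟩
  cases b
  · exact hz.1.1.2.trans_lt P.tau_lt_sh
  · obtain ⟨y', hy', hlow, -⟩ := h.exists_low (R := R) (by linarith)
    have h1 := hz.2 (vertexPt v, y') ⟨vertexPt_mem_slab v hy', vertexPt_mem_mixedInteger v y'⟩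
    rw [hardInstance_f_of_mem _ _ _ _ _ (slab_subset_box hR hslab),
      hardInstance_f_of_mem _ _ _ _ _ (slab_subset_box hR (vertexPt_mem_slab v hy'))] at h1
    simp only [objective, if_true] at h1
    have h2 := mul_le_mul_of_nonneg_left hlow hMR
    have h3 := hb rfl
    exact lt_of_mul_lt_mul_left (by linarith) hMR

open Classical in
/-- The separating vectors that are used as answers: they depend only on the queried point and on
the value and subgradient of the hidden function there. -/
noncomputable def sepAnswer (P : Profile) (R : ℝ) (b : Bool) (θ : Param n d) (z : Space n d) :
    Space n d :=
  if z ∈ region P R b θ then 0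
  else if z ∈ slab n d R then normalize (hidden P R θ z).2
  else Classical.epsilon (Separates (slab n d R) z)

lemma separates_sepAnswer (P : Profile) {R : ℝ} (hR : 0 ≤ R) {b : Bool} {θ : Param n d}
    (hne : (region P R b θ).Nonempty) {z : Space n d} (hz : z ∉ region P R b θ) :
    Separates (region P R b θ) z (sepAnswer P R b θ z) := by
  rw [sepAnswer, if_neg hz]
  split_ifs with hs
  · cases b
    · have hz' : P.tau < (hidden P R θ z).1 := not_le.1 fun h => hz ⟨hs, h⟩
      refine normalize_separates hne fun w hw => ?_
      have h1 := hidden_isSubgradient P R θ z w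
      have h2 : (hidden P R θ w).1 ≤ P.tau := hw.2
      rw [dot_sub] at h1
      linarith
    · exact absurd hs hz
  · have h := Classical.epsilon_spec (exists_separating (convex_slab R) (isClosed_slab R)
      ⟨(vertexPt fun _ => false, 0), vertexPt_mem_slab _ (by simpa using hR)⟩ hs)
    exact ⟨fun w hw => h.1 w (region_subset_slab P R b θ hw), h.2⟩

/-- For a suitable chart all answers on the hard instances are determined by the value and
subgradient of the hidden function at the queried point. -/
lemma exists_chart_hardInstance {Λ : Type} [Countable Λ] (P : Λ → Profile) {R M : ℝ} (ρ : ℝ)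
    (hMR : 0 ≤ M * R) (hR : 0 ≤ R) (hnd : 1 ≤ n + d) :
    ∃ (G : FirstOrderChart n d R ρ M) (c : Λ × Bool × Param n d → NNReal),
      ∀ (q : FirstOrderQuery n d R), ∃ z : Space n d, ∀ (a : Λ) (b : Bool) (θ θ' : Param n d),
        hidden (P a) R θ z = hidden (P a) R θ' z →
          (fullInformationOracle G).answer q (hardInstance (P a) hMR b θ (c (a, b, θ))) =
            (fullInformationOracle G).answer q (hardInstance (P a) hMR b θ' (c (a, b, θ'))) := by
  obtain ⟨c, hc⟩ := exists_injective_hardInstance (n := n) (d := d) P hMR hR hnd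
  obtain ⟨G, hG⟩ := exists_chart (R := R) (ρ := ρ) (M := M)
    (fun ω : Λ × Bool × Param n d => hardInstance (P ω.1) hMR ω.2.1 ω.2.2 (c ω)) hc
    (fun ω => sepAnswer (P ω.1) R ω.2.1 ω.2.2) (fun ω => objectiveGrad (P ω.1) R M ω.2.1 ω.2.2)
    (by
      intro ω z hz w
      rw [hardInstance_f_of_mem _ _ _ _ _ hz]
      have h := objectiveGrad_isSubgradient (P ω.1) hMR ω.2.1 ω.2.2 z w
      have h2 := mul_nonneg (c ω).2 (outside_nonneg R w)
      simp only [hardInstance]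
      exact h.trans (le_add_of_nonneg_right h2))
    (fun ω z hz => if_pos hz)
    (fun ω hω z _ hzC =>
      separates_sepAnswer _ hR (hω.feasible_nonempty.mono Set.inter_subset_left) hzC)
  have hregion : ∀ (a : Λ) (b : Bool) (θ θ' : Param n d) (z : Space n d),
      hidden (P a) R θ z = hidden (P a) R θ' z →
        (z ∈ region (P a) R b θ ↔ z ∈ region (P a) R b θ') := by
    intro a b θ θ' z h
    cases b <;> simp [region, h]
  refine ⟨G, c, fun q => ?_⟩
  cases q with
  | sep z =>
    refine ⟨z.1, fun a b θ θ' h => ?_⟩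
    have hr := propext (hregion a b θ θ' z.1 h)
    simp only [fullInformationOracle, (hG (a, b, θ) z).2.2, (hG (a, b, θ') z).2.2, sepAnswer, h]
    congr 2
  | val z =>
    refine ⟨z.1, fun a b θ θ' h => ?_⟩
    simp only [fullInformationOracle, (hG (a, b, θ) z).1, (hG (a, b, θ') z).1,
      hardInstance_f_of_mem _ _ _ _ _ z.2, objective, h]
  | sub z =>
    refine ⟨z.1, fun a b θ θ' h => ?_⟩
    simp only [fullInformationOracle, (hG (a, b, θ) z).2.1, (hG (a, b, θ') z).2.1, objectiveGrad,
      h]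

lemma two_le_rank {n d m : ℕ} (hnd : 1 ≤ n + d) (hm : 1 ≤ m) : 2 ≤ 2 ^ n * (d * m + 1) := by
  rcases Nat.eq_zero_or_pos n with rfl | hn
  · have : 1 ≤ d * m := Nat.mul_pos (by omega) hm
    omega
  · calc 2 = 2 ^ 1 * 1 := rfl
      _ ≤ 2 ^ n * (d * m + 1) :=
        Nat.mul_le_mul (Nat.pow_le_pow_right two_pos hn) (by omega)

/-- The lower bounds given by countably many profiles, for one and the same chart. -/
theorem exists_chart_le_icomp {Λ : Type} [Countable Λ] (P : Λ → Profile) {R ρ M : ℝ}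
    (hnd : 1 ≤ n + d) (hR : 1 ≤ R) (hρR : ρ ≤ R) (hM : 0 < M) :
    ∃ G : FirstOrderChart n d R ρ M, ∀ (ε : ℝ) (a : Λ), 1 ≤ (P a).rank →
      (M * R * (P a).low + ε < M * R * (P a).sh ∨ ρ ≤ R * (P a).rad) →
        ((2 ^ n * (d * (P a).rank + 1) - 1 : ℕ) : ℕ∞) ≤
          icomp ε (instanceClass n d R ρ M) (fullInformationOracle G) := by
  have hMR : 0 ≤ M * R := by positivity
  obtain ⟨G, c, hG⟩ := exists_chart_hardInstance (n := n) (d := d) P ρ hMR (by linarith) hnd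
  refine ⟨G, fun ε a hrank hcase => ?_⟩
  obtain ⟨b, hb1, hb2⟩ : ∃ b : Bool, (b = true → M * R * (P a).low + ε < M * R * (P a).sh) ∧
      (b = false → ρ ≤ R * (P a).rad) := by
    rcases hcase with h | h
    · exact ⟨true, fun _ => h, by simp⟩
    · exact ⟨false, by simp, fun _ => h⟩
  have htwo : 2 ≤ 2 ^ n * (d * (P a).rank + 1) := two_le_rank hnd hrank
  obtain ⟨N, hN⟩ := Nat.exists_eq_add_of_le htwo
  rw [hN, show 2 + N - 1 = N + 1 by omega]
  refine le_icomp fun D => ?_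
  obtain ⟨V, -, hV, hagree⟩ := exists_indistinguishable (fullInformationOracle G) D
    (fun θ : Param n d => hardInstance (P a) hMR b θ (c (a, b, θ))) (Survives (P a))
    (fun _ _ h => h.nonempty) (fun r V h q => by
      obtain ⟨z, hz⟩ := hG q
      obtain ⟨V', hV', hS, w, hw⟩ := h.step (R := R) z
      exact ⟨V', hV', hS, fun θ hθ θ' hθ' => hz a b θ θ' ((hw θ hθ).trans (hw θ' hθ').symm)⟩)
    N 2 _ (hN ▸ survives_initial (P a))
  obtain ⟨θ₁, hθ₁, θ₂, hθ₂, v₁, v₂, h₁, h₂, hne⟩ := hV.exists_pair le_rfl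
  refine ⟨_, h₁.isInClass hR hM hρR hMR hb2 _, _, h₂.isInClass hR hM hρR hMR hb2 _,
    (hagree θ₁ hθ₁ θ₂ hθ₂).2, fun z hz₁ hz₂ => ?_⟩
  obtain ⟨v, y, rfl, hlt⟩ := h₁.approx hR hMR hb1 _ hz₁
  obtain ⟨-, -, -, hlt'⟩ := h₂.approx hR hMR hb1 _ hz₂
  exact h₁.not_common h₂ hne v y hlt hlt'

end

/-! ### The numerical bounds -/

/-- A depth that is proportional to `log t` if `t` is large, and `1` otherwise. -/
lemma exists_depth {t : ℝ} (ht : 1 ≤ t) :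
    ∃ m : ℕ, 1 ≤ m ∧ Real.log t ≤ 8 * m ∧ (m = 1 ∨ (24 : ℝ) ^ m ≤ t / 2) := by
  have h2 := Real.log_two_lt_d9
  have h2' := Real.log_two_gt_d9
  rcases lt_or_ge t 2 with h | h
  · refine ⟨1, le_rfl, ?_, Or.inl rfl⟩
    have := Real.log_le_log (by linarith) h.le
    norm_num
    linarith
  · obtain ⟨m, hm1, hm2⟩ := exists_nat_pow_near (x := t / 2) (y := 24) (by linarith) (by norm_num)
    have hlog : Real.log t ≤ (5 * m + 6) * Real.log 2 := by
      have : t ≤ 2 ^ (5 * m + 6) := by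
        have h3 : (24 : ℝ) ^ (m + 1) ≤ 32 ^ (m + 1) := by gcongr; norm_num
        have h4 : (32 : ℝ) ^ (m + 1) * 2 = 2 ^ (5 * m + 6) := by
          rw [show (32 : ℝ) = 2 ^ 5 by norm_num, ← pow_mul, ← pow_succ]
          ring_nf
        linarith
      have := Real.log_le_log (by linarith) this
      rw [Real.log_pow] at this
      exact_mod_cast this
    rcases Nat.eq_zero_or_pos m with rfl | hm
    · refine ⟨1, le_rfl, ?_, Or.inl rfl⟩
      norm_num at hlog ⊢
      linarith
    · refine ⟨m, hm, ?_, Or.inr hm1⟩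
      have : (1 : ℝ) ≤ m := by exact_mod_cast hm
      nlinarith

end MICO

theorem corollary8 :
    ∃ c : ℝ, 0 < c ∧
      ∀ (n d : ℕ) (R ρ M : ℝ), 1 ≤ n + d → 1 ≤ R → 0 < ρ → ρ ≤ R → 0 < M →
        ∃ G : MICO.FirstOrderChart n d R ρ M,
          ∀ ε : ℝ, 0 < ε → ε < M * R →
            ENNReal.ofReal
                (c * (2 ^ n * (1 + (d : ℝ) * Real.log (M * R / (min ρ 1 * ε))))) ≤
              ((MICO.icomp ε (MICO.instanceClass n d R ρ M)
                (MICO.fullInformationOracle G) : ℕ∞) : ENNReal) := by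
  refine ⟨1 / 32, by norm_num, fun n d R ρ M hnd hR hρ hρR hM => ?_⟩
  obtain ⟨G, hG⟩ := MICO.exists_chart_le_icomp (n := n) (d := d) (ρ := ρ) (R := R) (M := M)
    (fun a : Option ℕ => a.elim MICO.signProfile MICO.treeProfile) hnd hR hρR hM
  refine ⟨G, fun ε hε hεMR => ?_⟩
  have hMR : 0 < M * R := by positivity
  have hmin : 0 < min ρ 1 := lt_min hρ one_pos
  -- depth one comes from the family of signs, for all accuracies
  have hone : ((2 ^ n * (d * 1 + 1) - 1 : ℕ) : ℕ∞) ≤ MICO.icomp ε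
      (MICO.instanceClass n d R ρ M) (MICO.fullInformationOracle G) := by
    refine hG ε none le_rfl (Or.inl ?_)
    change M * R * (-1) + ε < M * R * 0
    linarith
  have hdepth : ∀ t : ℝ, 1 ≤ t → (t ≤ M * R / ε ∨ t ≤ 1 / min ρ 1) →
      ∃ m : ℕ, 1 ≤ m ∧ Real.log t ≤ 8 * m ∧ ((2 ^ n * (d * m + 1) - 1 : ℕ) : ℕ∞) ≤
        MICO.icomp ε (MICO.instanceClass n d R ρ M) (MICO.fullInformationOracle G) := by
    intro t ht hcase
    obtain ⟨m, hm, hlog, rfl | hpow⟩ := MICO.exists_depth ht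
    · exact ⟨1, hm, hlog, hone⟩
    refine ⟨m, hm, hlog, hG ε (some m) hm ?_⟩
    rcases hcase with h | h
    · refine Or.inl ?_
      change M * R * MICO.treeLevel 0 m + ε < M * R * MICO.treeLevel 1 m
      have h1 := MICO.treeLevel_sub 1 0 m
      have h2 : (24 : ℝ) ^ m < M * R / ε := by
        have : (0 : ℝ) < 24 ^ m := by positivity
        linarith
      have h3 : ε < M * R * (1 / 24) ^ m := by
        rw [lt_div_iff₀ hε] at h2
        rw [one_div, inv_pow, ← div_eq_mul_inv, lt_div_iff₀ (by positivity)]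
        linarith
      have h4 : MICO.treeLevel 1 m = MICO.treeLevel 0 m + (1 / 24) ^ m := by linarith
      rw [h4, mul_add]
      linarith
    · refine Or.inr ?_
      change ρ ≤ R * (1 / 2 / 4 ^ m)
      have h1 : (4 : ℝ) ^ m ≤ 24 ^ m := by gcongr; norm_num
      have hpos : (1 : ℝ) ≤ 4 ^ m := one_le_pow₀ (by norm_num)
      have h2 : (4 : ℝ) ^ m * 2 ≤ 1 / min ρ 1 := by linarith
      have hρ1 : min ρ 1 = ρ := by
        rcases le_total ρ 1 with h3 | h3
        · exact min_eq_left h3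
        · rw [min_eq_right h3] at h2
          linarith
      rw [hρ1, le_div_iff₀ hρ] at h2
      have h3 : ρ ≤ 1 / 2 / 4 ^ m := by
        rw [le_div_iff₀ (by positivity)]
        linarith
      exact h3.trans (le_mul_of_one_le_left (by positivity) hR)
  obtain ⟨m₁, hm₁, hlog₁, hle₁⟩ := hdepth (M * R / ε) ((one_le_div hε).2 hεMR.le) (Or.inl le_rfl)
  obtain ⟨m₂, hm₂, hlog₂, hle₂⟩ := hdepth (1 / min ρ 1)
    ((one_le_div hmin).2 (min_le_right _ _)) (Or.inr le_rfl)
  have hlog : Real.log (M * R / (min ρ 1 * ε)) ≤ 8 * m₁ + 8 * m₂ := by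
    rw [show M * R / (min ρ 1 * ε) = M * R / ε * (1 / min ρ 1) by field_simp,
      Real.log_mul (by positivity) (by positivity)]
    linarith
  have hmax : ((2 ^ n * (d * max m₁ m₂ + 1) - 1 : ℕ) : ℕ∞) ≤
      MICO.icomp ε (MICO.instanceClass n d R ρ M) (MICO.fullInformationOracle G) := by
    rcases max_choice m₁ m₂ with h | h <;> rw [h] <;> assumption
  refine le_trans ?_ (ENat.toENNReal_mono hmax)
  rw [ENat.toENNReal_coe]
  refine ENNReal.ofReal_le_of_le_toReal ?_
  rw [ENNReal.toReal_natCast]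
  set m := max m₁ m₂ with hm
  have hm1 : 1 ≤ m := hm₁.trans (le_max_left _ _)
  have hlogm : Real.log (M * R / (min ρ 1 * ε)) ≤ 16 * m := by
    have h1 : (m₁ : ℝ) ≤ m := by exact_mod_cast le_max_left _ _
    have h2 : (m₂ : ℝ) ≤ m := by exact_mod_cast le_max_right _ _
    linarith
  have htwo : 2 ≤ 2 ^ n * (d * m + 1) := MICO.two_le_rank hnd hm1
  have htwo' : (2 : ℝ) ≤ 2 ^ n * (d * m + 1) := by exact_mod_cast htwo
  rw [Nat.cast_sub (by omega)]
  push_cast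
  have h1 : (d : ℝ) * Real.log (M * R / (min ρ 1 * ε)) ≤ d * (16 * m) := by gcongr
  have h2 : (2 : ℝ) ^ n * (1 + d * Real.log (M * R / (min ρ 1 * ε))) ≤
      2 ^ n * (1 + d * (16 * m)) := by gcongr
  have h3 : (2 : ℝ) ^ n * (1 + d * (16 * m)) ≤ 16 * (2 ^ n * (d * m + 1)) := by
    have : (0 : ℝ) < 2 ^ n := by positivity
    nlinarith
  linarith
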